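/- Let $V$ be a vertex operator algebra over $\mathbb{C}$: it is $\mathbb{Z}$-graded by the eigenvalues of $L(0)$, with finite-dimensional weight spaces $V_n$ that vanish for $n$ sufficiently negative. By a $V$-module $W$ we mean a module graded by the $L(0)$-eigenvalues $h\in\mathbb{C}$, $W=\coprod_{h\in\mathbb{C}}W_h$, with finite-dimensional weight spaces $W_h$ that vanish when the real part of $h$ is sufficiently negative. Write $Y^o_W(v,x)=Y_W(e^{xL(1)}(-x^{-2})^{L(0)}v,x^{-1})$ for the opposite vertex operator. The contragredient $W'$ of $W$ is the graded dual $\coprod_h W_h^*$ with vertex operators given by $\langle Y_{W'}(v,x)w',w\rangle=\langle w',Y^o_W(v,x)w\rangle$. A bilinear pairing $(\cdot,\cdot)$ between $V$-modules $W^{(1)}$ and $W^{(2)}$ is called invariant if $$(Y_{W^{(1)}}(v,x)w_{(1)},w_{(2)})=(w_{(1)},Y^o_{W^{(2)}}(v,x)w_{(2)})$$ for all $v\in V$, $w_{(1)}\in W^{(1)}$, $w_{(2)}\in W^{(2)}$. Suppose $V$ has a nondegenerate invariant bilinear form $(\cdot,\cdot)_V$, let $W^{(1)}$ and $W^{(2)}$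 be $V$-modules, and let $\mathcal{Y}$ be an intertwining operator of type $\binom{V}{W^{(1)}\,W^{(2)}}$. Put $$\mathcal{Y}^o_0(w_{(1)},x)w_{(2)}=\mathcal{Y}(e^{xL(1)}e^{\pi i L(0)}(x^{-L(0)})^2w_{(1)},x^{-1})w_{(2)},$$ and let $\mathcal{Y}^o_0(w_{(1)},e^{\pi i}x)$ be obtained from $\mathcal{Y}^o_0(w_{(1)},x)$ by replacing $x^p$ by $e^{\pi i p}x^p$ for every $p\in\mathbb{C}$. Then $$(w_{(1)},w_{(2)})=\mathrm{Res}_x\,x^{-1}\,(\mathbf{1},\mathcal{Y}^o_0(w_{(1)},e^{\pi i}x)\,e^{xL(1)}w_{(2)})_V$$ defines an invariant bilinear pairing between $W^{(1)}$ and $W^{(2)}$. If moreover $W^{(1)}$ and $W^{(2)}$ are irreducible and $\mathcal{Y}\neq 0$, then this pairing is nondegenerate, and $W^{(1)}$ and $W^{(2)}$ form a contragredient pair, that is, $W^{(1)}\cong (W^{(2)})'$ and $W^{(2)}\cong (W^{(1)})'$ as $V$-modules. -/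

import Mathlib

noncomputable section

namespace VOA

open Module

/-! ### The Jacobi identity, in modes

For `Y(v,x) = ∑ aᵢ(n) x^{-n-1}` acting on `Wᵢ` (`n ∈ ℤ`) and `I(w,x) = ∑ I w n x^{-n-1}`
(`n ∈ A`, with `A = ℤ` or `A = ℂ`), this is the equality of the coefficients of
`x₀^{-l-1} x₁^{-m-1} x₂^{-n-1}` in
`x₀⁻¹ δ((x₁-x₂)/x₀) Y(v,x₁) I(w₁,x₂) w₂ - x₀⁻¹ δ((x₂-x₁)/(-x₀)) I(w₁,x₂) Y(v,x₁) w₂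
  = x₂⁻¹ δ((x₁-x₀)/x₂) I(Y(v,x₀) w₁, x₂) w₂`.
All the sums are finite whenever `aᵢ` and `I` are lower truncated. -/
def JacobiIdentity {A W₁ W₂ W₃ : Type*} [AddCommGroupWithOne A]
    [AddCommGroup W₁] [Module ℂ W₁] [AddCommGroup W₂] [Module ℂ W₂]
    [AddCommGroup W₃] [Module ℂ W₃]
    (a₁ : ℤ → End ℂ W₁) (a₂ : ℤ → End ℂ W₂) (a₃ : ℤ → End ℂ W₃)
    (I : W₁ → A → W₂ →ₗ[ℂ] W₃) : Prop :=
  ∀ (w₁ : W₁) (w₂ : W₂) (l m : ℤ) (n : A),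
    (∑ᶠ i : ℕ, ((-1 : ℂ) ^ i * ((Ring.choose l i : ℤ) : ℂ)) •
        a₃ (m + l - i) (I w₁ (n + (i : A)) w₂))
      - (-1 : ℂ) ^ l • (∑ᶠ i : ℕ, ((-1 : ℂ) ^ i * ((Ring.choose l i : ℤ) : ℂ)) •
        I w₁ (n + (l : A) - (i : A)) (a₂ (m + i) w₂))
    = ∑ᶠ i : ℕ, ((Ring.choose m i : ℤ) : ℂ) • I (a₁ (l + i) w₁) ((m : A) + n - (i : A)) w₂

/-- A vertex operator algebra structure on the complex vector space `V`. The operator `L(n)` is the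
mode `ω_{n+1}`, and the weight space `V_n` is the eigenspace of `L(0)` for the eigenvalue `n`. The
lower truncation axiom is part of the type of `Y`. -/
structure VertexOperatorAlgebra (V : Type*) [AddCommGroup V] [Module ℂ V] where
  /-- the vertex operator map `v ↦ Y(v, x)` -/
  Y : V →ₗ[ℂ] VertexOperator ℂ V
  /-- the vacuum vector -/
  vac : V
  /-- the conformal vector -/
  conf : V
  /-- the central charge -/
  c : ℂ
  vacuum : ∀ (n : ℤ) (v : V), VertexOperator.ncoeff (Y vac) n v = if n = -1 then v else 0
  creation_nonneg : ∀ (v : V) (n : ℤ), 0 ≤ n → VertexOperator.ncoeff (Y v) n vac = 0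
  creation : ∀ v : V, VertexOperator.ncoeff (Y v) (-1) vac = v
  jacobi : ∀ u : V, JacobiIdentity (VertexOperator.ncoeff (Y u)) (VertexOperator.ncoeff (Y u))
    (VertexOperator.ncoeff (Y u)) (fun v => VertexOperator.ncoeff (Y v))
  virasoro : ∀ (m n : ℤ) (v : V),
    VertexOperator.ncoeff (Y conf) (m + 1) (VertexOperator.ncoeff (Y conf) (n + 1) v)
      - VertexOperator.ncoeff (Y conf) (n + 1) (VertexOperator.ncoeff (Y conf) (m + 1) v)
    = ((m : ℂ) - n) • VertexOperator.ncoeff (Y conf) (m + n + 1) v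
      + (if m + n = 0 then ((m : ℂ) ^ 3 - m) / 12 * c else 0) • v
  graded : DirectSum.IsInternal
    (fun n : ℤ => End.eigenspace (VertexOperator.ncoeff (Y conf) 1) (n : ℂ))
  finite_dim : ∀ n : ℤ,
    FiniteDimensional ℂ (End.eigenspace (VertexOperator.ncoeff (Y conf) 1) (n : ℂ))
  bounded_below : ∃ N : ℤ, ∀ n : ℤ, n < N →
    End.eigenspace (VertexOperator.ncoeff (Y conf) 1) (n : ℂ) = ⊥
  vac_mem : vac ∈ End.eigenspace (VertexOperator.ncoeff (Y conf) 1) (0 : ℂ)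
  conf_mem : conf ∈ End.eigenspace (VertexOperator.ncoeff (Y conf) 1) (2 : ℂ)
  /-- `Y(L(-1)v, x) = d/dx Y(v, x)` -/
  deriv : ∀ (v : V) (n : ℤ), VertexOperator.ncoeff (Y (VertexOperator.ncoeff (Y conf) 0 v)) n
    = (-(n : ℂ)) • VertexOperator.ncoeff (Y v) (n - 1)

/-- A module for a vertex operator algebra, on the complex vector space `W`: a module for `V` as a
vertex algebra, graded by the `L(0)`-eigenvalues `h ∈ ℂ`, with finite-dimensional weight spaces
that vanish when the real part of `h` is sufficiently negative. -/
structure VOAModule {V : Type*} [AddCommGroup V] [Module ℂ V] (𝒱 : VertexOperatorAlgebra V)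
    (W : Type*) [AddCommGroup W] [Module ℂ W] where
  /-- the vertex operator map `v ↦ Y_W(v, x)` -/
  Y : V →ₗ[ℂ] VertexOperator ℂ W
  vacuum : ∀ (n : ℤ) (w : W), VertexOperator.ncoeff (Y 𝒱.vac) n w = if n = -1 then w else 0
  jacobi : ∀ u : V, JacobiIdentity (VertexOperator.ncoeff (𝒱.Y u)) (VertexOperator.ncoeff (Y u))
    (VertexOperator.ncoeff (Y u)) (fun v => VertexOperator.ncoeff (Y v))
  graded : DirectSum.IsInternal
    (fun h : ℂ => End.eigenspace (VertexOperator.ncoeff (Y 𝒱.conf) 1) h)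
  finite_dim : ∀ h : ℂ,
    FiniteDimensional ℂ (End.eigenspace (VertexOperator.ncoeff (Y 𝒱.conf) 1) h)
  bounded_below : ∃ N : ℝ, ∀ h : ℂ, h.re < N →
    End.eigenspace (VertexOperator.ncoeff (Y 𝒱.conf) 1) h = ⊥

section Adjoint

variable {V : Type*} [AddCommGroup V] [Module ℂ V] (𝒱 : VertexOperatorAlgebra V)

theorem VertexOperatorAlgebra.iSup_eq_top :
    ⨆ h : ℂ, End.eigenspace (VertexOperator.ncoeff (𝒱.Y 𝒱.conf) 1) h = ⊤ := by
  rw [eq_top_iff, ← 𝒱.graded.submodule_iSup_eq_top]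
  exact iSup_le fun n => le_iSup
    (fun h : ℂ => End.eigenspace (VertexOperator.ncoeff (𝒱.Y 𝒱.conf) 1) h) (n : ℂ)

theorem VertexOperatorAlgebra.eigenspace_eq_bot {h : ℂ} (hh : ∀ n : ℤ, (n : ℂ) ≠ h) :
    End.eigenspace (VertexOperator.ncoeff (𝒱.Y 𝒱.conf) 1) h = ⊥ := by
  have hd := End.eigenspaces_iSupIndep (VertexOperator.ncoeff (𝒱.Y 𝒱.conf) 1) h
  rw [← disjoint_top, ← 𝒱.graded.submodule_iSup_eq_top]
  refine hd.mono_right (iSup_le fun n => ?_)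
  exact le_iSup₂ (f := fun (j : ℂ) (_ : j ≠ h) =>
    End.eigenspace (VertexOperator.ncoeff (𝒱.Y 𝒱.conf) 1) j) (n : ℂ) (hh n)

/-- `V` as a module for itself. -/
def VertexOperatorAlgebra.adjoint : VOAModule 𝒱 V where
  Y := 𝒱.Y
  vacuum := 𝒱.vacuum
  jacobi := 𝒱.jacobi
  graded := (DirectSum.isInternal_submodule_iff_iSupIndep_and_iSup_eq_top _).2
    ⟨End.eigenspaces_iSupIndep _, 𝒱.iSup_eq_top⟩
  finite_dim := fun h => by
    by_cases hh : ∃ n : ℤ, (n : ℂ) = h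
    · obtain ⟨n, rfl⟩ := hh
      exact 𝒱.finite_dim n
    · push Not at hh
      rw [𝒱.eigenspace_eq_bot hh]
      infer_instance
  bounded_below := by
    obtain ⟨N, hN⟩ := 𝒱.bounded_below
    refine ⟨N, fun h hlt => ?_⟩
    by_cases hh : ∃ n : ℤ, (n : ℂ) = h
    · obtain ⟨n, rfl⟩ := hh
      exact hN n (by simpa using hlt)
    · push Not at hh
      exact 𝒱.eigenspace_eq_bot hh

end Adjoint

namespace VOAModule

variable {V : Type*} [AddCommGroup V] [Module ℂ V] {𝒱 : VertexOperatorAlgebra V}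
variable {W : Type*} [AddCommGroup W] [Module ℂ W] (M : VOAModule 𝒱 W)

/-- The mode `v_n`, where `Y_W(v, x) = ∑ v_n x^{-n-1}`. -/
def mode (v : V) (n : ℤ) : End ℂ W := VertexOperator.ncoeff (M.Y v) n

/-- The Virasoro operator `L(n) = ω_{n+1}`. -/
def L (n : ℤ) : End ℂ W := M.mode 𝒱.conf (n + 1)

/-- The weight space `W_h`. -/
def wtSpace (h : ℂ) : Submodule ℂ W :=
  End.eigenspace (VertexOperator.ncoeff (M.Y 𝒱.conf) 1) h

/-- The projection of `W = ⨁ W_h` onto the weight space `W_h`. -/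
def wtProj (h : ℂ) : W →ₗ[ℂ] W :=
  (M.wtSpace h).subtype ∘ₗ DirectSum.component ℂ ℂ (fun k => M.wtSpace k) h ∘ₗ
    (LinearEquiv.ofBijective (DirectSum.coeLinearMap fun k => M.wtSpace k) M.graded).symm

/-- The mode `v^o_n` of the opposite vertex operator
`Y_W^o(v, x) = Y_W(e^{xL(1)} (-x^{-2})^{L(0)} v, x^{-1}) = ∑ v^o_n x^{-n-1}`. For `v ∈ V_j` this is
`∑_k (-1)^j (1/k!) (L(1)^k v)_{2j-k-n-2}`. -/
def oppMode (v : V) (n : ℤ) : End ℂ W :=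
  ∑ᶠ j : ℤ, (-1 : ℂ) ^ j • ∑ᶠ k : ℕ, (1 / (k.factorial : ℂ)) •
    M.mode ((𝒱.adjoint.L 1 ^ k) (𝒱.adjoint.wtProj (j : ℂ) v)) (2 * j - k - n - 2)

/-- Irreducibility: `W ≠ 0` and the only submodules are `0` and `W`. -/
def IsIrreducible : Prop :=
  Nontrivial W ∧ ∀ U : Submodule ℂ W,
    (∀ (v : V) (n : ℤ), ∀ w ∈ U, M.mode v n w ∈ U) → U = ⊥ ∨ U = ⊤

/-- The graded dual `W' = ⨁ W_h^*`: the linear functionals on `W = ⨁ W_h` that vanish on all but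
finitely many of the weight spaces. -/
def gradedDual : Submodule ℂ (Dual ℂ W) where
  carrier := {f | {h : ℂ | ∃ w ∈ M.wtSpace h, f w ≠ 0}.Finite}
  zero_mem' := by simp
  add_mem' := by
    intro f g hf hg
    refine (hf.union hg).subset ?_
    rintro h ⟨w, hw, hne⟩
    by_cases h0 : f w = 0
    · exact Or.inr ⟨w, hw, fun hg0 => hne (by simp [h0, hg0])⟩
    · exact Or.inl ⟨w, hw, h0⟩
  smul_mem' := by
    intro a f hf
    refine hf.subset ?_
    rintro h ⟨w, hw, hne⟩
    exact ⟨w, hw, fun h0 => hne (by simp [h0])⟩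

/-- The modes of the contragredient vertex operator, defined by
`⟨Y_{W'}(v,x) w', w⟩ = ⟨w', Y_W^o(v,x) w⟩`. -/
def contraMode (v : V) (n : ℤ) (f : Dual ℂ W) : Dual ℂ W := f ∘ₗ M.oppMode v n

/-- `W₁` is isomorphic, as a `V`-module, to the contragredient module of `W₂`. -/
def IsoContragredient {W₁ W₂ : Type*} [AddCommGroup W₁] [Module ℂ W₁] [AddCommGroup W₂]
    [Module ℂ W₂] (M₁ : VOAModule 𝒱 W₁) (M₂ : VOAModule 𝒱 W₂) : Prop :=
  ∃ φ : W₁ ≃ₗ[ℂ] M₂.gradedDual, ∀ (v : V) (n : ℤ) (w : W₁),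
    (φ (M₁.mode v n w) : Dual ℂ W₂) = M₂.contraMode v n (φ w : Dual ℂ W₂)

/-- `W₁` and `W₂` form a contragredient pair: each is isomorphic to the contragredient of the
other. -/
def IsContragredientPair {W₁ W₂ : Type*} [AddCommGroup W₁] [Module ℂ W₁] [AddCommGroup W₂]
    [Module ℂ W₂] (M₁ : VOAModule 𝒱 W₁) (M₂ : VOAModule 𝒱 W₂) : Prop :=
  IsoContragredient M₁ M₂ ∧ IsoContragredient M₂ M₁

/-- Invariance of a bilinear pairing:
`(Y_{W₁}(v,x) w₁, w₂) = (w₁, Y_{W₂}^o(v,x) w₂)`. -/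
def IsInvariant {W₁ W₂ : Type*} [AddCommGroup W₁] [Module ℂ W₁] [AddCommGroup W₂]
    [Module ℂ W₂] (M₁ : VOAModule 𝒱 W₁) (M₂ : VOAModule 𝒱 W₂) (B : W₁ →ₗ[ℂ] W₂ →ₗ[ℂ] ℂ) : Prop :=
  ∀ (v : V) (n : ℤ) (w₁ : W₁) (w₂ : W₂), B (M₁.mode v n w₁) w₂ = B w₁ (M₂.oppMode v n w₂)

end VOAModule

/-- An intertwining operator of type `W₃` over `W₁ W₂`. Here `coeff w n` is the mode `w_n`, where
`I(w, x) = ∑_{n ∈ ℂ} w_n x^{-n-1}`. -/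
structure IntertwiningOperator {V W₁ W₂ W₃ : Type*} [AddCommGroup V] [Module ℂ V]
    [AddCommGroup W₁] [Module ℂ W₁] [AddCommGroup W₂] [Module ℂ W₂] [AddCommGroup W₃] [Module ℂ W₃]
    {𝒱 : VertexOperatorAlgebra V}
    (M₁ : VOAModule 𝒱 W₁) (M₂ : VOAModule 𝒱 W₂) (M₃ : VOAModule 𝒱 W₃) where
  coeff : W₁ →ₗ[ℂ] (ℂ → (W₂ →ₗ[ℂ] W₃))
  truncation : ∀ (w₁ : W₁) (w₂ : W₂) (n : ℂ), ∃ N : ℕ, ∀ m : ℕ, N ≤ m → coeff w₁ (n + m) w₂ = 0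
  jacobi : ∀ v : V, JacobiIdentity (M₁.mode v) (M₂.mode v) (M₃.mode v) (fun w₁ => coeff w₁)
  /-- `I(L(-1)w, x) = d/dx I(w, x)` -/
  deriv : ∀ (w₁ : W₁) (n : ℂ), coeff (M₁.L (-1) w₁) n = (-n) • coeff w₁ (n - 1)

/-! ### Formal series with complex powers

A formal series `f = ∑_{p ∈ ℂ} f_p x^p` is the function `p ↦ f_p`. -/

/-- `Res_x f`, the coefficient of `x⁻¹`. -/
def formalRes {E : Type*} (f : ℂ → E) : E := f (-1)

/-- `x^a f(x)`. -/
def mulXPow {E : Type*} (a : ℂ) (f : ℂ → E) : ℂ → E := fun p => f (p - a)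

/-- `f(e^ζ x)`, where `(e^ζ x)^p = e^{ζ p} x^p`. -/
def substExp {E : Type*} [AddCommGroup E] [Module ℂ E] (ζ : ℂ) (f : ℂ → E) : ℂ → E :=
  fun p => Complex.exp (ζ * p) • f p

namespace IntertwiningOperator

variable {V W₁ W₂ W₃ : Type*} [AddCommGroup V] [Module ℂ V]
  [AddCommGroup W₁] [Module ℂ W₁] [AddCommGroup W₂] [Module ℂ W₂] [AddCommGroup W₃] [Module ℂ W₃]
  {𝒱 : VertexOperatorAlgebra V}
  {M₁ : VOAModule 𝒱 W₁} {M₂ : VOAModule 𝒱 W₂} {M₃ : VOAModule 𝒱 W₃}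

/-- The series `I^o_r(w, x) = I(e^{xL(1)} e^{(2r+1)πi L(0)} (x^{-L(0)})² w, x⁻¹)`; the value at `p`
is the coefficient of `x^p`. For `w` of weight `h` this coefficient is
`∑_k e^{(2r+1)πi h} (1/k!) (L(1)^k w)_{p-1-k+2h}`. -/
def opp (I : IntertwiningOperator M₁ M₂ M₃) (r : ℤ) (w : W₁) : ℂ → (W₂ →ₗ[ℂ] W₃) := fun p =>
  ∑ᶠ h : ℂ, Complex.exp ((2 * r + 1) * Real.pi * Complex.I * h) •
    ∑ᶠ k : ℕ, (1 / (k.factorial : ℂ)) •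
      I.coeff ((M₁.L 1 ^ k) (M₁.wtProj h w)) (p - 1 - k + 2 * h)

/-- For `I` with values in `V` and a bilinear form `(·,·)_V` on `V`, the formal series
`(𝟏, I^o_0(w₁, e^{πi} x) e^{xL(1)} w₂)_V`. -/
def contSeries (I : IntertwiningOperator M₁ M₂ 𝒱.adjoint) (form : V →ₗ[ℂ] V →ₗ[ℂ] ℂ)
    (w₁ : W₁) (w₂ : W₂) : ℂ → ℂ := fun p =>
  ∑ᶠ j : ℕ, form 𝒱.vac
    (substExp (Real.pi * Complex.I) (I.opp 0 w₁) (p - j)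
      ((1 / (j.factorial : ℂ)) • (M₂.L 1 ^ j) w₂))

/-- `Res_x x⁻¹ (𝟏, I^o_0(w₁, e^{πi} x) e^{xL(1)} w₂)_V`. -/
def contForm (I : IntertwiningOperator M₁ M₂ 𝒱.adjoint) (form : V →ₗ[ℂ] V →ₗ[ℂ] ℂ)
    (w₁ : W₁) (w₂ : W₂) : ℂ :=
  formalRes (mulXPow (-1) (I.contSeries form w₁ w₂))

end IntertwiningOperator

end VOA

end

/-!
Write `λ = (𝟏, ·)_V`. By invariance of the form and the vacuum axiom, `λ` is annihilated by the
opposite modes `v^o_n` with `n ≥ 0`. For `v` of weight `j`, apply the Jacobi identity for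
`L(1)^s v / s!` and `w₁` with exponents `l` of `x₁ - x₂` and `2j - 2 - l - s` of `x₁`, and sum over
`s`: `λ` kills the terms in which `v` acts last, and what remains says that the two-point function
`T(w₁, w₂) = λ(𝒴(w₁, 1) w₂)` intertwines `e^{L(1)} v_l e^{-L(1)}` on `W₁` with
`e^{-L(1)} v^o_l e^{L(1)}` on `W₂`, up to the sign `(-1)^{j+l+1}`. Hence
`E(w₁, w₂) = T(e^{L(1)} w₁, e^{-L(1)} w₂)` satisfies
`E(v_l w₁, w₂) = (-1)^{j+l+1} E(w₁, v^o_l w₂)`. The pairing of the theorem is `e^{πih} E(w₁, w₂)`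
for `w₁` of weight `h`; since `v_l` shifts weights by `j - l - 1`, the phase absorbs the sign.

If the pairing vanishes, then `λ` kills every coefficient of `𝒴(w₁, x) w₂`. By the commutator
formula it also kills all their images under modes, so nondegeneracy of the form gives `𝒴 = 0`.
As the left and right kernels of an invariant pairing are submodules, irreducibility makes a nonzero
pairing nondegenerate, and such a pairing identifies each module with the graded dual of the other.
-/

noncomputable section

namespace VOA

open Module
open Finset.HasAntidiagonal (antidiagonal mem_antidiagonal)

section FiniteSums

variable {E : Type*} [AddCommMonoid E]

theorem hasFiniteSupport_iff_exists_forall_ge {f : ℕ → E} :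
    f.HasFiniteSupport ↔ ∃ N, ∀ n, N ≤ n → f n = 0 := by
  rw [← Filter.eventually_atTop, ← Nat.cofinite_eq_atTop, Filter.eventually_cofinite]
  rfl

theorem finsum_eq_sum_range {f : ℕ → E} {N : ℕ} (h : ∀ n, N ≤ n → f n = 0) :
    ∑ᶠ n, f n = ∑ n ∈ Finset.range N, f n :=
  finsum_eq_sum_of_support_subset f fun n hn => by
    simpa using not_le.1 fun hle => hn (h n hle)

theorem finsum_ite_natCast_eq (k : ℤ) (f : ℤ → E) :
    ∑ᶠ i : ℕ, (if (i : ℤ) = k then f i else 0) = if 0 ≤ k then f k else 0 := by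
  split_ifs with hk
  · lift k to ℕ using hk
    rw [finsum_eq_single _ k fun i hi => if_neg (by exact_mod_cast hi), if_pos rfl]
  · exact finsum_eq_zero_of_forall_eq_zero fun i => if_neg (by omega)

theorem finsum_sum_antidiagonal {f : ℕ × ℕ → E} (hf : f.HasFiniteSupport) :
    ∑ᶠ n, ∑ p ∈ antidiagonal n, f p = ∑ᶠ p, ∑ᶠ q, f (p, q) := by
  classical
  have hf' : f.support.Finite := hf
  have hsupp : f.support ⊆ hf'.toFinset := hf'.coe_toFinset.ge
  rw [← finsum_curry f hf, finsum_eq_sum_of_support_subset f hsupp,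
    ← finsum_sum_filter (fun p : ℕ × ℕ => p.1 + p.2) hf'.toFinset f]
  refine finsum_congr fun n => (Finset.sum_subset (fun p hp => ?_) fun p hp hp' => ?_).symm
  · simpa using (Finset.mem_filter.1 hp).2
  · by_contra h
    exact hp' (Finset.mem_filter.2 ⟨hsupp h, by simpa using hp⟩)

theorem finsum_coeff_mul_smul {R : Type*} [Semiring R] [Module R E] (f g : PowerSeries R)
    {F : ℕ → E} (hF : F.HasFiniteSupport) :
    ∑ᶠ p, ∑ᶠ q, (f.coeff p * g.coeff q) • F (p + q) = ∑ᶠ n, (f * g).coeff n • F n := by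
  have hfin : (fun p : ℕ × ℕ => (f.coeff p.1 * g.coeff p.2) • F (p.1 + p.2)).HasFiniteSupport := by
    refine (hF.biUnion fun n _ => (antidiagonal n).finite_toSet).subset fun p hp => ?_
    simp only [Set.mem_iUnion]
    exact ⟨p.1 + p.2, fun h0 => hp (by simp [h0]), by simp⟩
  rw [← finsum_sum_antidiagonal hfin]
  refine finsum_congr fun n => ?_
  rw [PowerSeries.coeff_mul, Finset.sum_smul]
  exact Finset.sum_congr rfl fun p hp => by rw [mem_antidiagonal.1 hp]

theorem finsum_exp_mul_exp_neg_smul {𝕜 : Type*} [Field 𝕜] [CharZero 𝕜] [Module 𝕜 E]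
    {F : ℕ → E} (hF : F.HasFiniteSupport) :
    ∑ᶠ p : ℕ, ∑ᶠ q : ℕ, (1 / (p.factorial : 𝕜) * ((-1) ^ q * (1 / (q.factorial : 𝕜)))) •
      F (p + q) = F 0 := by
  have h := finsum_coeff_mul_smul (PowerSeries.exp 𝕜)
    (PowerSeries.evalNegHom (PowerSeries.exp 𝕜)) hF
  rw [PowerSeries.exp_mul_exp_neg_eq_one, finsum_eq_single (fun n => _ • F n) 0 fun n hn => by
    rw [PowerSeries.coeff_one, if_neg hn, zero_smul]] at h
  simpa [PowerSeries.evalNegHom, PowerSeries.coeff_rescale, PowerSeries.coeff_exp] using h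

theorem sum_smul_finsum_smul {R E ι : Type*} [CommSemiring R] [AddCommMonoid E] [Module R E]
    (s : Finset ℕ) (a : ℕ → R) (c : ι → R) {F : ℕ → ι → E} (hF : ∀ k, (F k).HasFiniteSupport) :
    ∑ k ∈ s, a k • ∑ᶠ i, c i • F k i = ∑ᶠ i, c i • ∑ k ∈ s, a k • F k i := by
  have hcF (k : ℕ) : (fun i => c i • F k i).HasFiniteSupport :=
    (hF k).subset fun i hi h0 => hi (by simp only [h0, smul_zero])
  simp only [Finset.smul_sum, smul_comm (c _)]
  rw [finsum_sum_comm _ _ fun k _ =>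
    (hcF k).subset fun i hi h0 => hi (by simp only [h0, smul_zero])]
  exact Finset.sum_congr rfl fun k _ => smul_finsum' _ (hcF k)

end FiniteSums

section LocallyFinite

variable {R ι κ E F G : Type*} [CommSemiring R] [AddCommMonoid E] [Module R E] [AddCommMonoid F]
  [Module R F] [AddCommMonoid G] [Module R G]

/-- A family of linear maps is locally finite if only finitely many of its members are nonzero on
each vector. -/
def IsLocallyFinite (f : ι → E →ₗ[R] F) : Prop := ∀ w, (fun i => f i w).HasFiniteSupport

theorem IsLocallyFinite.smul {f : ι → E →ₗ[R] F} (hf : IsLocallyFinite f) (c : ι → R) :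
    IsLocallyFinite fun i => c i • f i := fun w =>
  (hf w).subset fun i hi h0 => hi (by simp only [LinearMap.smul_apply, h0, smul_zero])

theorem IsLocallyFinite.comp {f : ι → E →ₗ[R] F} (hf : IsLocallyFinite f) (g : ι → F →ₗ[R] G) :
    IsLocallyFinite fun i => g i ∘ₗ f i := fun w =>
  (hf w).subset fun i hi h0 => hi (by simp only [LinearMap.comp_apply, h0, map_zero])

theorem IsLocallyFinite.comp_injective {f : ι → E →ₗ[R] F} (hf : IsLocallyFinite f) {g : κ → ι}
    (hg : Function.Injective g) : IsLocallyFinite fun i => f (g i) := fun w =>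
  (hf w).fun_comp_of_injective hg

theorem IsLocallyFinite.sum_antidiagonal {f : ℕ × ℕ → E →ₗ[R] F} (hf : IsLocallyFinite f) :
    IsLocallyFinite fun n => ∑ p ∈ antidiagonal n, f p := fun w => by
  refine ((hf w).image fun p => p.1 + p.2).subset fun n hn => ?_
  obtain ⟨p, hp, hp0⟩ := Finset.exists_ne_zero_of_sum_ne_zero
    ((LinearMap.sum_apply _ _ w).symm.trans_ne hn)
  exact ⟨p, hp0, mem_antidiagonal.1 hp⟩

/-- The sum of a locally finite family of linear maps. -/
def locSum (f : ι → E →ₗ[R] F) (hf : IsLocallyFinite f) : E →ₗ[R] F where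
  toFun w := ∑ᶠ i, f i w
  map_add' w w' := by
    simp only [map_add]
    exact finsum_add_distrib (hf w) (hf w')
  map_smul' c w := by
    simp only [map_smul, RingHom.id_apply]
    exact (smul_finsum' c (hf w)).symm

theorem locSum_apply (f : ι → E →ₗ[R] F) (hf : IsLocallyFinite f) (w : E) :
    locSum f hf w = ∑ᶠ i, f i w := rfl

theorem map_locSum (g : F →ₗ[R] G) (f : ι → E →ₗ[R] F) (hf : IsLocallyFinite f) (w : E) :
    g (locSum f hf w) = ∑ᶠ i, g (f i w) :=
  map_finsum g (hf w)

end LocallyFinite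

section Exponential

variable {𝕜 : Type*} [Field 𝕜]

/-- By `hR`, `R k = (ad L)^k (R 0) / k!`, so this is the binomial expansion of the `n`-th power of
left multiplication by `L`, the sum of `ad L` and right multiplication by `L`. -/
theorem pow_mul_eq_sum_antidiagonal [CharZero 𝕜] {A : Type*} [Ring A] [Algebra 𝕜 A] {L : A}
    {R : ℕ → A} (hR : ∀ k : ℕ, L * R k = R k * L + ((k : 𝕜) + 1) • R (k + 1)) (n : ℕ) :
    (1 / (n.factorial : 𝕜)) • (L ^ n * R 0) =
      ∑ p ∈ antidiagonal n, (1 / (p.2.factorial : 𝕜)) • (R p.1 * L ^ p.2) := by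
  set ad : End 𝕜 A := LinearMap.mulLeft 𝕜 L - LinearMap.mulRight 𝕜 L with had
  have had_pow (k : ℕ) : (ad ^ k) (R 0) = (k.factorial : 𝕜) • R k := by
    induction k with
    | zero => simp
    | succ k ih =>
      rw [pow_succ', End.mul_apply, ih, map_smul, had, LinearMap.sub_apply,
        LinearMap.mulLeft_apply, LinearMap.mulRight_apply, hR, add_sub_cancel_left, smul_smul,
        Nat.factorial_succ]
      push_cast
      ring_nf
  have hcomm : Commute ad (LinearMap.mulRight 𝕜 L) :=
    (LinearMap.commute_mulLeft_right L L).sub_left (Commute.refl _)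
  have hexpand : L ^ n * R 0 = ∑ p ∈ antidiagonal n,
      n.choose p.1 • ((p.1.factorial : 𝕜) • (R p.1 * L ^ p.2)) := by
    have h := LinearMap.congr_fun (hcomm.add_pow' n) (R 0)
    rw [had, sub_add_cancel, LinearMap.pow_mulLeft, LinearMap.mulLeft_apply, ← had] at h
    rw [h, LinearMap.sum_apply]
    refine Finset.sum_congr rfl fun p _ => ?_
    rw [(hcomm.pow_pow p.1 p.2).eq, LinearMap.smul_apply, End.mul_apply, had_pow,
      LinearMap.pow_mulRight, LinearMap.mulRight_apply, smul_mul_assoc]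
  rw [hexpand, Finset.smul_sum]
  refine Finset.sum_congr rfl fun p hp => ?_
  obtain rfl := mem_antidiagonal.1 hp
  have hfac (k : ℕ) : (k.factorial : 𝕜) ≠ 0 := Nat.cast_ne_zero.2 k.factorial_ne_zero
  have hchoose : ((p.1 + p.2).choose p.1 : 𝕜) * p.1.factorial * p.2.factorial =
      (p.1 + p.2).factorial := by
    rw [Nat.choose_symm_add]
    exact_mod_cast Nat.add_choose_mul_factorial_mul_factorial p.1 p.2
  rw [← Nat.cast_smul_eq_nsmul 𝕜, smul_smul, smul_smul]
  congr 1
  field_simp [hfac]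
  exact hchoose

variable {E : Type*} [AddCommGroup E] [Module 𝕜 E]

theorem IsLocallyFinite.pow_smul {L : End 𝕜 E} (hL : IsLocallyFinite (L ^ · : ℕ → End 𝕜 E))
    (x : 𝕜) : IsLocallyFinite ((x • L) ^ · : ℕ → End 𝕜 E) := by
  simpa only [smul_pow] using hL.smul (x ^ ·)

/-- The exponential of a locally nilpotent operator. -/
def locExp (L : End 𝕜 E) (hL : IsLocallyFinite (L ^ · : ℕ → End 𝕜 E)) : End 𝕜 E :=
  locSum (fun k : ℕ => (1 / (k.factorial : 𝕜)) • L ^ k) (hL.smul _)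

theorem locExp_apply (L : End 𝕜 E) (hL : IsLocallyFinite (L ^ · : ℕ → End 𝕜 E)) (w : E) :
    locExp L hL w = ∑ᶠ k : ℕ, (1 / (k.factorial : 𝕜)) • (L ^ k) w := rfl

theorem locExp_apply_locExp_neg_apply [CharZero 𝕜] {L : End 𝕜 E}
    (hL : IsLocallyFinite (L ^ · : ℕ → End 𝕜 E))
    (hL' : IsLocallyFinite ((-L) ^ · : ℕ → End 𝕜 E)) (w : E) :
    locExp L hL (locExp (-L) hL' w) = w := by
  have hneg_pow (k : ℕ) : ((-L) ^ k) w = (-1 : 𝕜) ^ k • (L ^ k) w := by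
    rw [← neg_one_smul 𝕜 L, smul_pow, LinearMap.smul_apply]
  rw [locExp_apply L]
  refine (finsum_congr fun p => ?_).trans (finsum_exp_mul_exp_neg_smul (𝕜 := 𝕜) (hL w))
  rw [locExp, map_locSum, smul_finsum]
  refine finsum_congr fun q => ?_
  rw [LinearMap.smul_apply, map_smul, hneg_pow, map_smul, smul_smul, smul_smul, ← End.mul_apply,
    ← pow_add]
  ring_nf

theorem locExp_apply_apply_zero [CharZero 𝕜] {L : End 𝕜 E}
    (hL : IsLocallyFinite (L ^ · : ℕ → End 𝕜 E)) {R : ℕ → End 𝕜 E}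
    (hR : ∀ k : ℕ, L * R k = R k * L + ((k : 𝕜) + 1) • R (k + 1)) (hfin : IsLocallyFinite R)
    (w : E) : locExp L hL (R 0 w) = locSum R hfin (locExp L hL w) := by
  have hf : (fun p : ℕ × ℕ =>
      (1 / (p.2.factorial : 𝕜)) • R p.1 ((L ^ p.2) w)).HasFiniteSupport := by
    refine (Set.Finite.biUnion (hL w) (t := fun q => (fun p => (p, q)) '' {p | R p ((L ^ q) w) ≠ 0})
      fun q _ => (hfin _).image _).subset fun p hp => ?_
    have hp' : R p.1 ((L ^ p.2) w) ≠ 0 := fun h0 => hp (by simp [h0])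
    simp only [Set.mem_iUnion]
    exact ⟨p.2, fun h0 => hp' (by simp only [] at h0; rw [h0, map_zero]), p.1, hp', rfl⟩
  rw [locExp_apply, locSum_apply]
  trans ∑ᶠ p, ∑ᶠ q, (1 / (q.factorial : 𝕜)) • R p ((L ^ q) w)
  · rw [← finsum_sum_antidiagonal hf]
    refine finsum_congr fun n => ?_
    simpa using LinearMap.congr_fun (pow_mul_eq_sum_antidiagonal hR n) w
  · refine finsum_congr fun p => ?_
    rw [locExp, map_locSum]
    exact finsum_congr fun q => (map_smul _ _ _).symm

end Exponential

section Jacobi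

variable {A W₁ W₂ W₃ : Type*} [AddCommGroupWithOne A] [AddCommGroup W₁] [Module ℂ W₁]
  [AddCommGroup W₂] [Module ℂ W₂] [AddCommGroup W₃] [Module ℂ W₃] {a₁ : ℤ → End ℂ W₁}
  {a₂ : ℤ → End ℂ W₂} {a₃ : ℤ → End ℂ W₃} {I : W₁ → A → W₂ →ₗ[ℂ] W₃}

theorem JacobiIdentity.commutator (h : JacobiIdentity a₁ a₂ a₃ I) (w₁ : W₁) (w₂ : W₂) (m : ℤ)
    (n : A) :
    a₃ m (I w₁ n w₂) - I w₁ n (a₂ m w₂) =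
      ∑ᶠ i : ℕ, ((Ring.choose m i : ℤ) : ℂ) • I (a₁ i w₁) ((m : A) + n - (i : A)) w₂ := by
  have hchoose (i : ℕ) (hi : i ≠ 0) : Ring.choose (0 : ℤ) i = 0 :=
    Ring.choose_zero_pos ℤ (Nat.pos_of_ne_zero hi)
  have h0 := h w₁ w₂ 0 m n
  rw [finsum_eq_single _ 0 fun i hi => by simp [hchoose i hi],
    finsum_eq_single _ 0 fun i hi => by simp [hchoose i hi]] at h0
  simpa using h0

theorem JacobiIdentity.commutator_natCast (h : JacobiIdentity a₁ a₂ a₃ I) (w₁ : W₁) (w₂ : W₂)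
    (m : ℕ) (n : A) :
    a₃ m (I w₁ n w₂) - I w₁ n (a₂ m w₂) =
      ∑ i ∈ Finset.range (m + 1), (m.choose i : ℂ) • I (a₁ i w₁) ((m : A) + n - (i : A)) w₂ := by
  rw [h.commutator, finsum_eq_sum_range (N := m + 1) fun i hi => by
    rw [Ring.choose_natCast, Nat.choose_eq_zero_of_lt hi]; simp]
  simp [Ring.choose_natCast]

end Jacobi

section Coefficients

theorem neg_one_pow_mul_choose_neg_two (i : ℕ) :
    (-1 : ℂ) ^ i * ((Ring.choose (-2 : ℤ) i : ℤ) : ℂ) = i + 1 := by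
  have h : Ring.choose (-2 : ℤ) i = (-1) ^ i * (i + 1) := by
    rw [Ring.choose_neg, show (2 : ℤ) + i - 1 = ((i + 1 : ℕ) : ℤ) by push_cast; ring,
      Ring.choose_natCast, Nat.choose_succ_self_right, Int.negOnePow_def]
    simp [Units.smul_def, mul_add]
  rw [h]
  push_cast
  rw [← mul_assoc, ← mul_pow]
  simp

theorem sum_range_inv_factorial_smul_succ {E : Type*} [AddCommGroup E] [Module ℂ E]
    {Z : ℕ → E} {S : ℕ} (hZ : Z S = 0) :
    ∑ k ∈ Finset.range S, (1 / (k.factorial : ℂ)) • Z (k + 1) =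
      ∑ k ∈ Finset.range S, (k * (1 / (k.factorial : ℂ))) • Z k := by
  have h := (Finset.sum_range_succ (fun k : ℕ => (k * (1 / (k.factorial : ℂ))) • Z k) S).symm.trans
    (Finset.sum_range_succ' _ S)
  rw [hZ, smul_zero, add_zero, Nat.cast_zero, zero_mul, zero_smul, add_zero] at h
  rw [h]
  refine Finset.sum_congr rfl fun k _ => ?_
  have hk := Nat.cast_add_one_ne_zero (R := ℂ) k
  rw [Nat.factorial_succ]
  push_cast
  congr 1
  field_simp

theorem succ_mul_choose_succ (r : ℤ) (i : ℕ) :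
    ((i : ℂ) + 1) * ((Ring.choose r (i + 1) : ℤ) : ℂ) =
      ((r : ℂ) - i) * ((Ring.choose r i : ℤ) : ℂ) := by
  have h := Ring.choose_smul_choose r (Nat.le_succ i)
  rw [Nat.succ_eq_add_one, Nat.choose_succ_self_right, Nat.add_sub_cancel_left,
    Ring.choose_one_right, nsmul_eq_mul, mul_comm (Ring.choose r i)] at h
  exact_mod_cast congr_arg (Int.cast : ℤ → ℂ) h

/-- The coefficient of `(L(1)^s v)_{l+i}` in `e^{L(1)} v_l e^{-L(1)}`, for `v` of weight `j` and
`m = 2j - 2 - l`. -/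
def conjCoeff (m : ℤ) (s i : ℕ) : ℂ := 1 / (s.factorial : ℂ) * ((Ring.choose (m - s) i : ℤ) : ℂ)

theorem succ_smul_sum_conjCoeff_smul {E : Type*} [AddCommGroup E] [Module ℂ E] (m : ℤ) (k : ℕ)
    (X : ℕ → ℕ → E) :
    ((k : ℂ) + 1) • ∑ p ∈ antidiagonal (k + 1), conjCoeff m p.1 p.2 • X p.1 p.2 =
      ∑ p ∈ antidiagonal k, conjCoeff m p.1 p.2 •
        (((m : ℂ) - 2 * p.1 - p.2) • X p.1 (p.2 + 1) + X (p.1 + 1) p.2) := by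
  -- `(s + i) c(s, i) = (m - 2s - (i - 1)) c(s, i - 1) + c(s - 1, i)` for `c = conjCoeff m`, by
  -- Pascal's rule; `α` and `β` are the two summands.
  let β (s i : ℕ) : ℂ := s * (1 / (s.factorial : ℂ)) * ((Ring.choose (m - s + 1) i : ℤ) : ℂ)
  let α (s i : ℕ) : ℂ := (s + i) * conjCoeff m s i - β s i
  have hβ_zero (i : ℕ) : β 0 i = 0 := by simp [β]
  have hβ_succ (s i : ℕ) : β (s + 1) i = conjCoeff m s i := by
    have hs := Nat.cast_add_one_ne_zero (R := ℂ) s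
    simp only [β, conjCoeff, Nat.factorial_succ]
    rw [show m - ((s + 1 : ℕ) : ℤ) + 1 = m - s by push_cast; ring]
    push_cast
    field_simp
  have hα_zero (s : ℕ) : α s 0 = 0 := by simp [α, β, conjCoeff]
  have hα_succ (s i : ℕ) : α s (i + 1) = conjCoeff m s i * ((m : ℂ) - 2 * s - i) := by
    have h := succ_mul_choose_succ (m - s) i
    simp only [α, β, conjCoeff, Ring.choose_succ_succ]
    push_cast at h ⊢
    linear_combination (1 / (s.factorial : ℂ)) * h
  have hsplit : ((k : ℂ) + 1) • ∑ p ∈ antidiagonal (k + 1), conjCoeff m p.1 p.2 • X p.1 p.2 =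
      ∑ p ∈ antidiagonal (k + 1), α p.1 p.2 • X p.1 p.2 +
        ∑ p ∈ antidiagonal (k + 1), β p.1 p.2 • X p.1 p.2 := by
    rw [Finset.smul_sum, ← Finset.sum_add_distrib]
    refine Finset.sum_congr rfl fun p hp => ?_
    have hk : (k : ℂ) + 1 = p.1 + p.2 := by exact_mod_cast (mem_antidiagonal.1 hp).symm
    rw [← add_smul, smul_smul, hk]
    simp only [α, sub_add_cancel]
  rw [hsplit, Finset.Nat.sum_antidiagonal_succ' (n := k), Finset.Nat.sum_antidiagonal_succ]
  simp only [hα_zero, hβ_zero, hα_succ, hβ_succ, zero_smul, zero_add, smul_add, smul_smul,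
    Finset.sum_add_distrib]

end Coefficients

theorem VertexOperatorAlgebra.wtSpace_induction {V : Type*} [AddCommGroup V] [Module ℂ V]
    (𝒱 : VertexOperatorAlgebra V) {p : V → Prop} (hom : ∀ j : ℤ, ∀ v ∈ 𝒱.adjoint.wtSpace j, p v)
    (add : ∀ v v', p v → p v' → p (v + v')) (v : V) : p v :=
  Submodule.iSup_induction (fun j : ℤ => 𝒱.adjoint.wtSpace j) (motive := p)
    ((𝒱.graded.submodule_iSup_eq_top : ⨆ j : ℤ, 𝒱.adjoint.wtSpace j = ⊤) ▸ Submodule.mem_top)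
    hom (hom 0 0 (zero_mem _)) add

namespace VOAModule

section Basic

variable {V : Type*} [AddCommGroup V] [Module ℂ V] {𝒱 : VertexOperatorAlgebra V}
variable {W : Type*} [AddCommGroup W] [Module ℂ W] (M : VOAModule 𝒱 W)

/-- The mode `v_n` as a linear function of `v`. -/
def modeHom (n : ℤ) : V →ₗ[ℂ] End ℂ W := LinearMap.proj n ∘ₗ VertexOperator.ncoeff ∘ₗ M.Y

theorem mode_add (v v' : V) (n : ℤ) : M.mode (v + v') n = M.mode v n + M.mode v' n :=
  map_add (M.modeHom n) v v'

theorem mode_smul (c : ℂ) (v : V) (n : ℤ) : M.mode (c • v) n = c • M.mode v n :=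
  map_smul (M.modeHom n) c v

theorem mode_zero (n : ℤ) : M.mode 0 n = 0 := map_zero (M.modeHom n)

theorem isLocallyFinite_mode (v : V) (n : ℤ) :
    IsLocallyFinite fun i : ℕ => M.mode v (n + i) := fun w =>
  hasFiniteSupport_iff_exists_forall_ge.2
    ⟨(-HahnSeries.order ((HahnModule.of ℂ).symm (M.Y v w)) - n).toNat, fun i hi =>
      VertexOperator.ncoeff_eq_zero_of_lt_order _ _ _ (by omega)⟩

theorem jacobi_mode (u : V) : JacobiIdentity (𝒱.adjoint.mode u) (M.mode u) (M.mode u)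
    (fun v => M.mode v) := M.jacobi u

theorem mode_vac (n : ℤ) (w : W) : M.mode 𝒱.vac n w = if n = -1 then w else 0 := M.vacuum n w

theorem L_neg_one_eq_mode_vac (v : V) : 𝒱.adjoint.L (-1) v = 𝒱.adjoint.mode v (-2) 𝒱.vac := by
  have h := LinearMap.congr_fun (𝒱.deriv v (-1)) 𝒱.vac
  rw [𝒱.creation] at h
  simpa [L, mode, VertexOperatorAlgebra.adjoint] using h

/-- As `L(-1)v = v_{-2} 𝟏`, this is the Jacobi identity for `v` and `𝟏` with `l = -2`, `m = 0`. -/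
theorem mode_L_neg_one (v : V) (n : ℤ) :
    M.mode (𝒱.adjoint.L (-1) v) n = (-(n : ℂ)) • M.mode v (n - 1) := by
  ext w
  have h := M.jacobi_mode v 𝒱.vac w (-2) 0 n
  rw [finsum_eq_single (fun i : ℕ => ((Ring.choose (0 : ℤ) i : ℤ) : ℂ) • _) 0
    fun i hi => by simp [Ring.choose_zero_pos ℤ (Nat.pos_of_ne_zero hi)]] at h
  simp only [neg_one_pow_mul_choose_neg_two, mode_vac] at h
  have hfirst : ∑ᶠ i : ℕ, ((i : ℂ) + 1) • M.mode v (0 + -2 - i) (if n + i = -1 then w else 0) =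
      if 0 ≤ -1 - n then (-(n : ℂ)) • M.mode v (n - 1) w else 0 := by
    convert finsum_ite_natCast_eq (-1 - n) (fun i => ((i : ℂ) + 1) • M.mode v (0 + -2 - i) w)
      using 3 with i
    · split_ifs <;> first | omega | simp
    · push_cast; ring
    · congr 2; ring
  have hsecond : ∑ᶠ i : ℕ, ((i : ℂ) + 1) • (if n + -2 - i = -1 then M.mode v (0 + i) w else 0) =
      if 0 ≤ n - 1 then (n : ℂ) • M.mode v (n - 1) w else 0 := by
    convert finsum_ite_natCast_eq (n - 1) (fun i => ((i : ℂ) + 1) • M.mode v (0 + i) w)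
      using 3 with i
    · split_ifs <;> first | omega | simp
    · push_cast; ring
    · congr 2; ring
  simp only [Int.cast_id] at h
  rw [hfirst, hsecond] at h
  rw [L_neg_one_eq_mode_vac, LinearMap.smul_apply]
  trans (if 0 ≤ -1 - n then (-(n : ℂ)) • M.mode v (n - 1) w else 0) -
      (-1 : ℂ) ^ (-2 : ℤ) • if 0 ≤ n - 1 then (n : ℂ) • M.mode v (n - 1) w else 0
  · simpa using h.symm
  · rcases lt_trichotomy n 0 with hn | rfl | hn
    · rw [if_pos (by omega), if_neg (by omega)]; simp
    · simp
    · rw [if_neg (by omega), if_pos (by omega)]; simp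

theorem mem_wtSpace_iff {h : ℂ} {w : W} : w ∈ M.wtSpace h ↔ M.L 0 w = h • w :=
  End.mem_eigenspace_iff

theorem L_zero_mode_apply (v : V) (n : ℤ) (w : W) :
    M.L 0 (M.mode v n w) =
      M.mode v n (M.L 0 w) + M.mode (𝒱.adjoint.L 0 v) n w - ((n : ℂ) + 1) • M.mode v n w := by
  have hcomm := (M.jacobi_mode 𝒱.conf).commutator_natCast v w 1 n
  have hderiv := LinearMap.congr_fun (M.mode_L_neg_one v (n + 1)) w
  simp only [Finset.sum_range_succ, Finset.sum_range_zero] at hcomm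
  simp only [L, Int.reduceAdd] at hderiv ⊢
  simp only [Nat.cast_one, Nat.choose_succ_self_right, zero_add, Nat.cast_zero, add_comm 1 n,
    sub_zero, hderiv, add_sub_cancel_right, LinearMap.smul_apply, one_smul,
    Nat.choose_self] at hcomm
  rw [sub_eq_iff_eq_add.1 hcomm]
  push_cast
  module

theorem L_one_mul_mode (v : V) (n : ℤ) :
    M.L 1 * M.mode v n = M.mode v n * M.L 1 + M.mode (𝒱.adjoint.L 1 v) n +
      (2 : ℂ) • M.mode (𝒱.adjoint.L 0 v) (n + 1) - ((n : ℂ) + 2) • M.mode v (n + 1) := by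
  ext w
  have hcomm := (M.jacobi_mode 𝒱.conf).commutator_natCast v w 2 n
  have hderiv := LinearMap.congr_fun (M.mode_L_neg_one v (n + 2)) w
  simp only [Finset.sum_range_succ, Finset.sum_range_zero] at hcomm
  simp only [L, Int.reduceAdd] at hderiv ⊢
  simp only [Nat.cast_ofNat, Nat.choose_zero_right, Nat.cast_one, Nat.cast_zero, add_comm 2 n,
    sub_zero, hderiv, LinearMap.smul_apply, one_smul, zero_add, Nat.choose_succ_self_right,
    Nat.reduceAdd, Nat.choose_self, add_sub_cancel_right, show n + 2 - 1 = n + 1 by ring] at hcomm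
  simp only [LinearMap.add_apply, LinearMap.sub_apply, LinearMap.smul_apply, End.mul_apply]
  rw [sub_eq_iff_eq_add.1 hcomm]
  push_cast
  module

theorem L_one_mul_mode_of_mem {v : V} {j : ℂ} (hv : v ∈ 𝒱.adjoint.wtSpace j) (n : ℤ) :
    M.L 1 * M.mode v n = M.mode v n * M.L 1 +
      ((2 * j - 2 - n) • M.mode v (n + 1) + M.mode (𝒱.adjoint.L 1 v) n) := by
  rw [L_one_mul_mode, (mem_wtSpace_iff _).1 hv, mode_smul]
  module

theorem mode_mem_wtSpace {v : V} {j : ℂ} (hv : v ∈ 𝒱.adjoint.wtSpace j) {w : W} {h : ℂ}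
    (hw : w ∈ M.wtSpace h) (n : ℤ) : M.mode v n w ∈ M.wtSpace (h + j - n - 1) := by
  rw [mem_wtSpace_iff] at *
  rw [L_zero_mode_apply, hv, hw, mode_smul, map_smul, LinearMap.smul_apply]
  module

theorem L_one_pow_mem_wtSpace {w : W} {h : ℂ} (hw : w ∈ M.wtSpace h) (k : ℕ) :
    (M.L 1 ^ k) w ∈ M.wtSpace (h - k) := by
  induction k with
  | zero => simpa using hw
  | succ k ih =>
    have hmem : M.L 1 ((M.L 1 ^ k) w) ∈ _ := M.mode_mem_wtSpace 𝒱.conf_mem ih 2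
    rw [pow_succ', End.mul_apply]
    convert hmem using 2
    push_cast
    ring

theorem wtSpace_induction {p : W → Prop} (hom : ∀ h, ∀ w ∈ M.wtSpace h, p w)
    (add : ∀ w w', p w → p w' → p (w + w')) (w : W) : p w :=
  Submodule.iSup_induction M.wtSpace (motive := p)
    ((M.graded.submodule_iSup_eq_top : ⨆ h, M.wtSpace h = ⊤) ▸ Submodule.mem_top) hom
    (hom 0 0 (zero_mem _)) add

theorem isLocallyFinite_L_one_pow : IsLocallyFinite (M.L 1 ^ · : ℕ → End ℂ W) := by
  intro w
  induction w using M.wtSpace_induction with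
  | hom h w hw =>
    obtain ⟨N, hN⟩ := M.bounded_below
    obtain ⟨K, hK⟩ := exists_nat_gt (h.re - N)
    refine hasFiniteSupport_iff_exists_forall_ge.2 ⟨K, fun k hk => ?_⟩
    have hkK : (K : ℝ) ≤ k := by exact_mod_cast hk
    have hbot : M.wtSpace (h - k) = ⊥ := hN _ (by simp; linarith)
    simpa [hbot] using M.L_one_pow_mem_wtSpace hw k
  | add w w' h h' =>
    simp only [map_add]
    exact h.add h'

theorem exists_L_one_pow_eq_zero (w : W) : ∃ S : ℕ, ∀ k, S ≤ k → (M.L 1 ^ k) w = 0 :=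
  hasFiniteSupport_iff_exists_forall_ge.1 (M.isLocallyFinite_L_one_pow w)

theorem wtProj_eq_component {h : ℂ} {w : W} (hw : w ∈ M.wtSpace h) (h' : ℂ) :
    M.wtProj h' w =
      DirectSum.component ℂ ℂ _ h' (DirectSum.lof ℂ ℂ (fun k => M.wtSpace k) h ⟨w, hw⟩) := by
  have : (LinearEquiv.ofBijective (DirectSum.coeLinearMap fun k => M.wtSpace k) M.graded).symm w =
      DirectSum.lof ℂ ℂ (fun k => M.wtSpace k) h ⟨w, hw⟩ := by
    rw [LinearEquiv.symm_apply_eq]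
    exact (DirectSum.coeLinearMap_lof (fun k => M.wtSpace k) h ⟨w, hw⟩).symm
  simp [wtProj, this]

theorem wtProj_of_mem {h : ℂ} {w : W} (hw : w ∈ M.wtSpace h) : M.wtProj h w = w := by
  rw [M.wtProj_eq_component hw, DirectSum.component.lof_self]

theorem wtProj_of_mem_ne {h h' : ℂ} {w : W} (hw : w ∈ M.wtSpace h) (hne : h' ≠ h) :
    M.wtProj h' w = 0 := by
  rw [M.wtProj_eq_component hw, DirectSum.component.of, dif_neg hne.symm, ZeroMemClass.coe_zero]

theorem isLocallyFinite_wtProj : IsLocallyFinite M.wtProj := by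
  intro w
  induction w using M.wtSpace_induction with
  | hom h w hw =>
    exact (Set.finite_singleton h).subset fun h' hh' =>
      by_contra fun hne => hh' (M.wtProj_of_mem_ne hw hne)
  | add w w' h h' =>
    simp only [map_add]
    exact h.add h'

end Basic

section Opposite

variable {V : Type*} [AddCommGroup V] [Module ℂ V] {𝒱 : VertexOperatorAlgebra V}
variable {W : Type*} [AddCommGroup W] [Module ℂ W] (M : VOAModule 𝒱 W)

/-- The opposite mode `v^o_n` as a linear function of `v`. -/
def oppModeHom (n : ℤ) : V →ₗ[ℂ] End ℂ W :=
  locSum (fun j : ℤ => (-1 : ℂ) ^ j •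
      locSum (fun k : ℕ => (1 / (k.factorial : ℂ)) •
        (M.modeHom (2 * j - k - n - 2) ∘ₗ 𝒱.adjoint.L 1 ^ k))
        ((𝒱.adjoint.isLocallyFinite_L_one_pow.comp _).smul _) ∘ₗ 𝒱.adjoint.wtProj j)
    (((𝒱.adjoint.isLocallyFinite_wtProj.comp_injective Int.cast_injective).comp _).smul _)

theorem oppMode_add (v v' : V) (n : ℤ) :
    M.oppMode (v + v') n = M.oppMode v n + M.oppMode v' n :=
  map_add (M.oppModeHom n) v v'

theorem oppMode_of_mem {v : V} {j : ℤ} (hv : v ∈ 𝒱.adjoint.wtSpace j) {S : ℕ}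
    (hS : ∀ k, S ≤ k → (𝒱.adjoint.L 1 ^ k) v = 0) (n : ℤ) :
    M.oppMode v n = (-1 : ℂ) ^ j • ∑ k ∈ Finset.range S, (1 / (k.factorial : ℂ)) •
      M.mode ((𝒱.adjoint.L 1 ^ k) v) (2 * j - k - n - 2) := by
  rw [oppMode, finsum_eq_single _ j fun i hi => by
      rw [𝒱.adjoint.wtProj_of_mem_ne hv (by exact_mod_cast hi)]; simp [mode_zero],
    𝒱.adjoint.wtProj_of_mem hv,
    finsum_eq_sum_range fun k hk => by rw [hS k hk, mode_zero, smul_zero]]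

theorem sum_mode_L_one_pow_of_mem {v : V} {j : ℤ} (hv : v ∈ 𝒱.adjoint.wtSpace j) {S : ℕ}
    (hS : ∀ k, S ≤ k → (𝒱.adjoint.L 1 ^ k) v = 0) (n : ℤ) :
    ∑ k ∈ Finset.range S, (1 / (k.factorial : ℂ)) •
      M.mode ((𝒱.adjoint.L 1 ^ k) v) (2 * j - k - n - 2) = (-1 : ℂ) ^ j • M.oppMode v n := by
  rw [M.oppMode_of_mem hv hS, smul_smul, ← zpow_add₀ (by norm_num), Even.neg_one_zpow ⟨j, rfl⟩,
    one_smul]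

theorem sum_smul_finsum_mode {v : V} {j : ℤ} (hv : v ∈ 𝒱.adjoint.wtSpace j) {S : ℕ}
    (hS : ∀ k, S ≤ k → (𝒱.adjoint.L 1 ^ k) v = 0) (c : ℕ → ℂ) {n : ℕ → ℤ} {m : ℕ → ℕ → ℤ}
    (hm : ∀ s i, m s i = 2 * j - s - n i - 2) {w : ℕ → W}
    (hfin : ∀ s, (fun i => M.mode ((𝒱.adjoint.L 1 ^ s) v) (m s i) (w i)).HasFiniteSupport) :
    ∑ s ∈ Finset.range S, (1 / (s.factorial : ℂ)) •
        ∑ᶠ i, c i • M.mode ((𝒱.adjoint.L 1 ^ s) v) (m s i) (w i) =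
      (-1 : ℂ) ^ j • ∑ᶠ i, c i • M.oppMode v (n i) (w i) := by
  rw [sum_smul_finsum_smul _ _ _ hfin, smul_finsum]
  refine finsum_congr fun i => ?_
  have h := LinearMap.congr_fun (M.sum_mode_L_one_pow_of_mem hv hS (n i)) (w i)
  simp only [LinearMap.sum_apply, LinearMap.smul_apply] at h
  simp only [hm, h, smul_comm (c i)]

theorem L_one_conf : 𝒱.adjoint.L 1 𝒱.conf = 0 := by
  have h := 𝒱.virasoro 1 (-2) 𝒱.vac
  rw [𝒱.creation_nonneg 𝒱.conf (1 + 1) (by norm_num),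
    𝒱.creation_nonneg 𝒱.conf (1 + -2 + 1) (by norm_num), show (-2 : ℤ) + 1 = -1 by norm_num,
    𝒱.creation, map_zero] at h
  simpa [L, mode, VertexOperatorAlgebra.adjoint] using h

theorem oppMode_conf_one : M.oppMode 𝒱.conf 1 = M.L 0 := by
  have hS (k : ℕ) (hk : 1 ≤ k) : (𝒱.adjoint.L 1 ^ k) 𝒱.conf = 0 := by
    obtain ⟨k, rfl⟩ := Nat.exists_eq_add_of_le' hk
    rw [pow_succ, End.mul_apply, L_one_conf, map_zero]
  rw [M.oppMode_of_mem (j := 2) (by exact_mod_cast 𝒱.conf_mem) hS]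
  simp [L]

theorem L_one_mul_oppMode (v : V) (n : ℤ) :
    M.L 1 * M.oppMode v n = M.oppMode v n * M.L 1 + (n : ℂ) • M.oppMode v (n - 1) := by
  induction v using 𝒱.wtSpace_induction with
  | add v v' h h' =>
    simp only [oppMode_add, mul_add, add_mul, smul_add, h, h']
    abel
  | hom j v hv =>
    obtain ⟨S, hS⟩ := 𝒱.adjoint.exists_L_one_pow_eq_zero v
    let Z (k : ℕ) : End ℂ W := M.mode ((𝒱.adjoint.L 1 ^ k) v) (2 * j - k - (n - 1) - 2)
    have hZ : Z S = 0 := by simp only [Z, hS S le_rfl, mode_zero]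
    have hcomm (k : ℕ) : M.L 1 * M.mode ((𝒱.adjoint.L 1 ^ k) v) (2 * j - k - n - 2) =
        M.mode ((𝒱.adjoint.L 1 ^ k) v) (2 * j - k - n - 2) * M.L 1 +
          (((n : ℂ) - k) • Z k + Z (k + 1)) := by
      rw [M.L_one_mul_mode_of_mem (𝒱.adjoint.L_one_pow_mem_wtSpace hv k),
        ← End.mul_apply (𝒱.adjoint.L 1), ← pow_succ']
      congr! 3
      · push_cast; ring
      · simp only [Z]; ring_nf
      · push_cast; ring
    simp only [M.oppMode_of_mem hv hS, mul_smul_comm, smul_mul_assoc, Finset.mul_sum,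
      Finset.sum_mul, hcomm, smul_add, Finset.sum_add_distrib,
      sum_range_inv_factorial_smul_succ hZ]
    rw [← smul_add, ← Finset.sum_add_distrib, smul_comm (n : ℂ),
      Finset.smul_sum (r := (n : ℂ))]
    refine congrArg _ (congrArg _ (Finset.sum_congr rfl fun k _ => ?_))
    module

theorem isLocallyFinite_oppMode (v : V) (n : ℤ) :
    IsLocallyFinite fun a : ℕ => M.oppMode v (n - a) := by
  intro w
  induction v using 𝒱.wtSpace_induction with
  | add v v' h h' =>
    simp only [oppMode_add, LinearMap.add_apply]
    exact h.add h'
  | hom j v hv =>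
    obtain ⟨S, hS⟩ := 𝒱.adjoint.exists_L_one_pow_eq_zero v
    refine (Set.Finite.biUnion (Finset.range S).finite_toSet fun k _ =>
      M.isLocallyFinite_mode ((𝒱.adjoint.L 1 ^ k) v) (2 * j - k - n - 2) w).subset fun a ha => ?_
    by_contra hzero
    simp only [Set.mem_iUnion, Function.mem_support, not_exists, not_not] at hzero
    refine ha ?_
    simp only [M.oppMode_of_mem hv hS, LinearMap.smul_apply, LinearMap.sum_apply]
    rw [Finset.sum_eq_zero fun k hk => ?_, smul_zero]
    rw [show 2 * j - k - (n - a) - 2 = 2 * j - k - n - 2 + a by ring, hzero k hk, smul_zero]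

end Opposite

section Conjugation

variable {V : Type*} [AddCommGroup V] [Module ℂ V] {𝒱 : VertexOperatorAlgebra V}
variable {W : Type*} [AddCommGroup W] [Module ℂ W] (M : VOAModule 𝒱 W)

/-- The homogeneous components of `e^{L(1)} v_l e^{-L(1)}`, for `v` of weight `j`: the `k`-th one
raises weights by `k` less than `v_l` does. -/
def conjMode (j : ℤ) (v : V) (l : ℤ) (k : ℕ) : End ℂ W :=
  ∑ p ∈ antidiagonal k,
    conjCoeff (2 * j - 2 - l) p.1 p.2 • M.mode ((𝒱.adjoint.L 1 ^ p.1) v) (l + p.2)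

theorem L_one_mul_conjMode {v : V} {j : ℤ} (hv : v ∈ 𝒱.adjoint.wtSpace j) (l : ℤ) (k : ℕ) :
    M.L 1 * M.conjMode j v l k =
      M.conjMode j v l k * M.L 1 + ((k : ℂ) + 1) • M.conjMode j v l (k + 1) := by
  have hcomm (s i : ℕ) : M.L 1 * M.mode ((𝒱.adjoint.L 1 ^ s) v) (l + i) =
      M.mode ((𝒱.adjoint.L 1 ^ s) v) (l + i) * M.L 1 +
        ((((2 * j - 2 - l : ℤ) : ℂ) - 2 * s - i) •
          M.mode ((𝒱.adjoint.L 1 ^ s) v) (l + (i + 1 : ℕ)) +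
            M.mode ((𝒱.adjoint.L 1 ^ (s + 1)) v) (l + i)) := by
    rw [M.L_one_mul_mode_of_mem (𝒱.adjoint.L_one_pow_mem_wtSpace hv s), pow_succ' _ s,
      End.mul_apply]
    congr! 3
    · push_cast; ring
    · rw [Nat.cast_succ, add_assoc]
  rw [conjMode, conjMode, succ_smul_sum_conjCoeff_smul (2 * j - 2 - l) k fun s i =>
    M.mode ((𝒱.adjoint.L 1 ^ s) v) (l + i), Finset.mul_sum, Finset.sum_mul,
    ← Finset.sum_add_distrib]
  simp only [mul_smul_comm, smul_mul_assoc, hcomm, smul_add]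

theorem isLocallyFinite_conjCoeff_smul_mode (v : V) (m l : ℤ) :
    IsLocallyFinite fun p : ℕ × ℕ =>
      conjCoeff m p.1 p.2 • M.mode ((𝒱.adjoint.L 1 ^ p.1) v) (l + p.2) := by
  refine IsLocallyFinite.smul (fun w => ?_) _
  refine ((𝒱.adjoint.isLocallyFinite_L_one_pow v).biUnion fun s _ =>
    (M.isLocallyFinite_mode ((𝒱.adjoint.L 1 ^ s) v) l w).image (Prod.mk s)).subset fun p hp => ?_
  simp only [Set.mem_iUnion]
  refine ⟨p.1, fun h0 => hp ?_, p.2, hp, rfl⟩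
  simp only [] at h0
  simp [h0, mode_zero]

theorem isLocallyFinite_conjMode (j : ℤ) (v : V) (l : ℤ) : IsLocallyFinite (M.conjMode j v l) :=
  (M.isLocallyFinite_conjCoeff_smul_mode v _ l).sum_antidiagonal

theorem locSum_conjMode_apply {v : V} {S : ℕ} (hS : ∀ k, S ≤ k → (𝒱.adjoint.L 1 ^ k) v = 0)
    (j l : ℤ) (w : W) :
    locSum (M.conjMode j v l) (M.isLocallyFinite_conjMode j v l) w =
      ∑ s ∈ Finset.range S, (1 / (s.factorial : ℂ)) • ∑ᶠ i : ℕ,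
        ((Ring.choose (2 * j - 2 - l - s) i : ℤ) : ℂ) •
          M.mode ((𝒱.adjoint.L 1 ^ s) v) (l + i) w := by
  simp only [locSum_apply, conjMode, LinearMap.sum_apply]
  rw [finsum_sum_antidiagonal (M.isLocallyFinite_conjCoeff_smul_mode v (2 * j - 2 - l) l w),
    finsum_eq_sum_range (N := S) fun s hs => by simp [hS s hs, mode_zero]]
  simp only [conjCoeff, LinearMap.smul_apply, mul_smul, smul_finsum]

/-- The homogeneous components of `e^{-L(1)} v^o_l e^{L(1)}`. -/
def conjOppMode (v : V) (l : ℤ) (a : ℕ) : End ℂ W :=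
  ((-1 : ℂ) ^ a * ((Ring.choose l a : ℤ) : ℂ)) • M.oppMode v (l - a)

theorem neg_L_one_mul_conjOppMode (v : V) (l : ℤ) (a : ℕ) :
    -M.L 1 * M.conjOppMode v l a =
      M.conjOppMode v l a * -M.L 1 + ((a : ℂ) + 1) • M.conjOppMode v l (a + 1) := by
  have hscalar : ((a : ℂ) + 1) * ((-1) ^ (a + 1) * ((Ring.choose l (a + 1) : ℤ) : ℂ)) =
      -((-1) ^ a * ((Ring.choose l a : ℤ) : ℂ) * (l - a : ℤ)) := by
    push_cast
    linear_combination (-1 : ℂ) ^ (a + 1) * succ_mul_choose_succ l a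
  rw [conjOppMode, conjOppMode, smul_smul, hscalar, neg_mul, mul_smul_comm, L_one_mul_oppMode,
    Nat.cast_succ, ← sub_sub]
  simp only [mul_neg, smul_mul_assoc]
  module

theorem isLocallyFinite_conjOppMode (v : V) (l : ℤ) : IsLocallyFinite (M.conjOppMode v l) :=
  (M.isLocallyFinite_oppMode v l).smul _

/-- The operator `e^{xL(1)}`. -/
def expL (x : ℂ) : End ℂ W := locExp (x • M.L 1) (M.isLocallyFinite_L_one_pow.pow_smul x)

theorem map_expL {E : Type*} [AddCommGroup E] [Module ℂ E] (g : W →ₗ[ℂ] E) (x : ℂ) (w : W) :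
    g (M.expL x w) = ∑ᶠ k : ℕ, (x ^ k * (1 / (k.factorial : ℂ))) • g ((M.L 1 ^ k) w) := by
  rw [expL, locExp, map_locSum]
  exact finsum_congr fun k => by
    rw [smul_pow, smul_smul, mul_comm, LinearMap.smul_apply, map_smul]

theorem expL_apply_expL_neg_apply (x : ℂ) (w : W) : M.expL x (M.expL (-x) w) = w := by
  simp only [expL, neg_smul]
  exact locExp_apply_locExp_neg_apply _ _ w

theorem expL_one_mode {v : V} {j : ℤ} (hv : v ∈ 𝒱.adjoint.wtSpace j) (l : ℤ) (w : W) :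
    M.expL 1 (M.mode v l w) =
      locSum (M.conjMode j v l) (M.isLocallyFinite_conjMode j v l) (M.expL 1 w) := by
  have h := locExp_apply_apply_zero (M.isLocallyFinite_L_one_pow.pow_smul 1)
    (R := M.conjMode j v l) (fun k => by rw [one_smul, M.L_one_mul_conjMode hv])
    (M.isLocallyFinite_conjMode j v l) w
  simpa [conjMode, conjCoeff, expL] using h

theorem expL_neg_one_oppMode (v : V) (l : ℤ) (w : W) :
    M.expL (-1) (M.oppMode v l w) =
      locSum (M.conjOppMode v l) (M.isLocallyFinite_conjOppMode v l) (M.expL (-1) w) := by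
  have h := locExp_apply_apply_zero (M.isLocallyFinite_L_one_pow.pow_smul (-1))
    (R := M.conjOppMode v l) (fun a => by rw [neg_one_smul, neg_L_one_mul_conjOppMode])
    (M.isLocallyFinite_conjOppMode v l) w
  simpa [conjOppMode, expL] using h

end Conjugation

section VacuumLike

variable {V : Type*} [AddCommGroup V] [Module ℂ V] {𝒱 : VertexOperatorAlgebra V}
variable {W : Type*} [AddCommGroup W] [Module ℂ W] (M : VOAModule 𝒱 W)

/-- A functional on `W` is vacuum-like if the modes `v_n` with `n ≥ 0` of the contragredient vertex
operators annihilate it. The functional `(𝟏, ·)_V` on `V` has this property. -/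
def IsVacuumLike (f : Dual ℂ W) : Prop := ∀ (v : V) (n : ℤ), 0 ≤ n → M.contraMode v n f = 0

variable {M}

theorem IsVacuumLike.eq_zero_of_mem {f : Dual ℂ W} (hf : M.IsVacuumLike f) {w : W} {h : ℂ}
    (hw : w ∈ M.wtSpace h) (hh : h ≠ 0) : f w = 0 := by
  have h0 : f (M.oppMode 𝒱.conf 1 w) = 0 := LinearMap.congr_fun (hf 𝒱.conf 1 zero_le_one) w
  rw [oppMode_conf_one, (M.mem_wtSpace_iff).1 hw, map_smul, smul_eq_mul] at h0
  exact (mul_eq_zero.1 h0).resolve_left hh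

theorem IsVacuumLike.apply_finsum_oppMode_eq_zero {f : Dual ℂ W} (hf : M.IsVacuumLike f)
    (c : ℕ → ℂ) (v : V) (w : ℕ → W) : f (∑ᶠ i : ℕ, c i • M.oppMode v i (w i)) = 0 := by
  refine finsum_induction (fun w => f w = 0) (map_zero f)
    (fun x y hx hy => by rw [map_add, hx, hy, add_zero]) fun i => ?_
  rw [map_smul, show f (M.oppMode v i (w i)) = 0 from
    LinearMap.congr_fun (hf v i (Int.natCast_nonneg i)) _, smul_zero]

theorem contraMode_apply_eq_zero {f : Dual ℂ W} {w : W} (h : ∀ v n, f (M.mode v n w) = 0) (v : V)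
    (n : ℤ) : M.contraMode v n f w = 0 := by
  change f (M.oppMode v n w) = 0
  induction v using 𝒱.wtSpace_induction with
  | hom j v hv =>
    obtain ⟨S, hS⟩ := 𝒱.adjoint.exists_L_one_pow_eq_zero v
    simp only [M.oppMode_of_mem hv hS, LinearMap.smul_apply, LinearMap.sum_apply, map_smul, map_sum,
      h, smul_zero, Finset.sum_const_zero]
  | add v v' h h' => rw [M.oppMode_add, LinearMap.add_apply, map_add, h, h', add_zero]

end VacuumLike

section Bilinear

variable {V W₁ W₂ E : Type*} [AddCommGroup V] [Module ℂ V] [AddCommGroup W₁] [Module ℂ W₁]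
  [AddCommGroup W₂] [Module ℂ W₂] [AddCommGroup E] [Module ℂ E] {𝒱 : VertexOperatorAlgebra V}

theorem bilin_ext (M₁ : VOAModule 𝒱 W₁) (M₂ : VOAModule 𝒱 W₂) {A B : W₁ →ₗ[ℂ] W₂ →ₗ[ℂ] E}
    (hom : ∀ h₁, ∀ w₁ ∈ M₁.wtSpace h₁, ∀ h₂, ∀ w₂ ∈ M₂.wtSpace h₂, A w₁ w₂ = B w₁ w₂) :
    A = B := by
  ext w₁ w₂
  induction w₁ using M₁.wtSpace_induction with
  | add w w' h h' => simp only [map_add, LinearMap.add_apply, h, h']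
  | hom h₁ w₁ hw₁ =>
    induction w₂ using M₂.wtSpace_induction with
    | add w w' h h' => simp only [map_add, h, h']
    | hom h₂ w₂ hw₂ => exact hom h₁ w₁ hw₁ h₂ w₂ hw₂

theorem apply_eq_zero_of_ne {M₁ : VOAModule 𝒱 W₁} {M₂ : VOAModule 𝒱 W₂} {B : W₁ →ₗ[ℂ] W₂ →ₗ[ℂ] E}
    {w₁ : W₁} {w₂ : W₂} {h₁ h₂ : ℂ} (hB : B (M₁.L 0 w₁) w₂ = B w₁ (M₂.L 0 w₂))
    (hw₁ : w₁ ∈ M₁.wtSpace h₁) (hw₂ : w₂ ∈ M₂.wtSpace h₂) (hne : h₁ ≠ h₂) : B w₁ w₂ = 0 := by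
  rw [M₁.mem_wtSpace_iff.1 hw₁, M₂.mem_wtSpace_iff.1 hw₂, map_smul, map_smul,
    LinearMap.smul_apply, ← sub_eq_zero, ← sub_smul] at hB
  exact (smul_eq_zero.1 hB).resolve_left (sub_ne_zero.2 hne)

end Bilinear

end VOAModule

namespace IntertwiningOperator

variable {V W₁ W₂ W₃ : Type*} [AddCommGroup V] [Module ℂ V]
  [AddCommGroup W₁] [Module ℂ W₁] [AddCommGroup W₂] [Module ℂ W₂] [AddCommGroup W₃] [Module ℂ W₃]
  {𝒱 : VertexOperatorAlgebra V}
  {M₁ : VOAModule 𝒱 W₁} {M₂ : VOAModule 𝒱 W₂} {M₃ : VOAModule 𝒱 W₃}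
  (I : IntertwiningOperator M₁ M₂ M₃)

theorem coeff_mem_wtSpace {w₁ : W₁} {w₂ : W₂} {h₁ h₂ : ℂ} (hw₁ : w₁ ∈ M₁.wtSpace h₁)
    (hw₂ : w₂ ∈ M₂.wtSpace h₂) (n : ℂ) : I.coeff w₁ n w₂ ∈ M₃.wtSpace (h₁ + h₂ - n - 1) := by
  have hcomm := (I.jacobi 𝒱.conf).commutator_natCast w₁ w₂ 1 n
  have hderiv := LinearMap.congr_fun (I.deriv w₁ (n + 1)) w₂
  have hzero₁ : M₁.mode 𝒱.conf 1 w₁ = h₁ • w₁ := M₁.mem_wtSpace_iff.1 hw₁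
  have hzero₂ : M₂.mode 𝒱.conf 1 w₂ = h₂ • w₂ := M₂.mem_wtSpace_iff.1 hw₂
  rw [VOAModule.mem_wtSpace_iff]
  simp only [VOAModule.L, Int.reduceAdd, add_sub_cancel_right, LinearMap.smul_apply] at hderiv ⊢
  simp only [Finset.sum_range_succ, Finset.sum_range_zero, Nat.cast_one, Nat.cast_zero,
    Nat.choose_zero_right, Nat.choose_self, zero_add, one_smul, sub_zero, add_comm 1 n,
    add_sub_cancel_right, hderiv, hzero₁, hzero₂, map_smul, Pi.smul_apply,
    LinearMap.smul_apply] at hcomm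
  rw [sub_eq_iff_eq_add.1 hcomm]
  module

section TwoPoint

variable {f : Dual ℂ W₃} (hf : M₃.IsVacuumLike f)

include hf in
theorem apply_coeff_eq_zero {w₁ : W₁} {w₂ : W₂} {h₁ h₂ : ℂ} (hw₁ : w₁ ∈ M₁.wtSpace h₁)
    (hw₂ : w₂ ∈ M₂.wtSpace h₂) {n : ℂ} (hn : n ≠ h₁ + h₂ - 1) : f (I.coeff w₁ n w₂) = 0 :=
  hf.eq_zero_of_mem (I.coeff_mem_wtSpace hw₁ hw₂ n) fun h0 => hn (by linear_combination -h0)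

include hf in
theorem hasFiniteSupport_apply_coeff (w₁ : W₁) (w₂ : W₂) :
    (fun n => f (I.coeff w₁ n w₂)).HasFiniteSupport := by
  induction w₁ using M₁.wtSpace_induction with
  | add w w' h h' =>
    simp only [map_add, Pi.add_apply, LinearMap.add_apply]
    exact h.add h'
  | hom h₁ w₁ hw₁ =>
    induction w₂ using M₂.wtSpace_induction with
    | add w w' h h' =>
      simp only [map_add]
      exact h.add h'
    | hom h₂ w₂ hw₂ =>
      exact (Set.finite_singleton (h₁ + h₂ - 1)).subset fun n hn =>
        by_contra fun hne => hn (I.apply_coeff_eq_zero hf hw₁ hw₂ hne)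

/-- The pairing `f(I(w₁, x) w₂)` at `x = 1`. -/
def twoPoint : W₁ →ₗ[ℂ] W₂ →ₗ[ℂ] ℂ :=
  LinearMap.mk₂ ℂ (fun w₁ w₂ => ∑ᶠ n, f (I.coeff w₁ n w₂))
    (fun w w' w₂ => by
      simp only [map_add, Pi.add_apply, LinearMap.add_apply]
      exact finsum_add_distrib (I.hasFiniteSupport_apply_coeff hf _ _)
        (I.hasFiniteSupport_apply_coeff hf _ _))
    (fun c w w₂ => by simp only [map_smul, Pi.smul_apply, LinearMap.smul_apply, smul_finsum])
    (fun w₁ w w' => by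
      simp only [map_add]
      exact finsum_add_distrib (I.hasFiniteSupport_apply_coeff hf _ _)
        (I.hasFiniteSupport_apply_coeff hf _ _))
    (fun c w₁ w => by simp only [map_smul, smul_finsum])

theorem twoPoint_of_mem {w₁ : W₁} {w₂ : W₂} {h₁ h₂ : ℂ} (hw₁ : w₁ ∈ M₁.wtSpace h₁)
    (hw₂ : w₂ ∈ M₂.wtSpace h₂) {n : ℂ} (hn : n = h₁ + h₂ - 1) :
    I.twoPoint hf w₁ w₂ = f (I.coeff w₁ n w₂) :=
  finsum_eq_single _ n fun _ hn' => I.apply_coeff_eq_zero hf hw₁ hw₂ (hn ▸ hn')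

theorem twoPoint_jacobi {v : V} {j : ℂ} (hv : v ∈ 𝒱.adjoint.wtSpace j) {w₁ : W₁} {w₂ : W₂}
    {h₁ h₂ : ℂ} (hw₁ : w₁ ∈ M₁.wtSpace h₁) (hw₂ : w₂ ∈ M₂.wtSpace h₂) {l m : ℤ} {n : ℂ}
    (hn : n = h₁ + h₂ + j - l - m - 2) :
    I.twoPoint hf (∑ᶠ i : ℕ, ((Ring.choose m i : ℤ) : ℂ) • M₁.mode v (l + i) w₁) w₂ =
      f (∑ᶠ i : ℕ, ((-1 : ℂ) ^ i * ((Ring.choose l i : ℤ) : ℂ)) •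
        M₃.mode v (m + l - i) (I.coeff w₁ (n + i) w₂)) -
      (-1 : ℂ) ^ l * I.twoPoint hf w₁ (∑ᶠ i : ℕ, ((-1 : ℂ) ^ i * ((Ring.choose l i : ℤ) : ℂ)) •
        M₂.mode v (m + i) w₂) := by
  have hfin₁ := (M₁.isLocallyFinite_mode v l).smul (fun i => ((Ring.choose m i : ℤ) : ℂ)) w₁
  have hfin₂ := (M₂.isLocallyFinite_mode v m).smul
    (fun i => (-1 : ℂ) ^ i * ((Ring.choose l i : ℤ) : ℂ)) w₂
  simp only [LinearMap.smul_apply] at hfin₁ hfin₂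
  have hleft : I.twoPoint hf (∑ᶠ i : ℕ, ((Ring.choose m i : ℤ) : ℂ) • M₁.mode v (l + i) w₁) w₂ =
      f (∑ᶠ i : ℕ, ((Ring.choose m i : ℤ) : ℂ) •
        I.coeff (M₁.mode v (l + i) w₁) (m + n - i) w₂) := by
    have hfin : (fun i : ℕ => ((Ring.choose m i : ℤ) : ℂ) •
        I.coeff (M₁.mode v (l + i) w₁) (m + n - i) w₂).HasFiniteSupport :=
      hfin₁.subset fun i hi h0 => hi (by rcases smul_eq_zero.1 h0 with h0 | h0 <;> simp [h0])
    rw [← LinearMap.flip_apply, map_finsum _ hfin₁, map_finsum f hfin]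
    refine finsum_congr fun i => ?_
    rw [map_smul, map_smul, LinearMap.flip_apply,
      I.twoPoint_of_mem hf (M₁.mode_mem_wtSpace hv hw₁ (l + i)) hw₂ (n := m + n - i)]
    rw [hn]
    push_cast
    ring
  have hright : I.twoPoint hf w₁ (∑ᶠ i : ℕ, ((-1 : ℂ) ^ i * ((Ring.choose l i : ℤ) : ℂ)) •
        M₂.mode v (m + i) w₂) =
      f (∑ᶠ i : ℕ, ((-1 : ℂ) ^ i * ((Ring.choose l i : ℤ) : ℂ)) •
        I.coeff w₁ (n + l - i) (M₂.mode v (m + i) w₂)) := by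
    have hfin : (fun i : ℕ => ((-1 : ℂ) ^ i * ((Ring.choose l i : ℤ) : ℂ)) •
        I.coeff w₁ (n + l - i) (M₂.mode v (m + i) w₂)).HasFiniteSupport :=
      hfin₂.subset fun i hi h0 => hi (by rcases smul_eq_zero.1 h0 with h0 | h0 <;> simp [h0])
    rw [map_finsum _ hfin₂, map_finsum f hfin]
    refine finsum_congr fun i => ?_
    rw [map_smul, map_smul, I.twoPoint_of_mem hf hw₁ (M₂.mode_mem_wtSpace hv hw₂ (m + i))
      (n := n + l - i)]
    rw [hn]
    push_cast
    ring
  rw [hleft, hright, ← I.jacobi v w₁ w₂ l m n, map_sub, map_smul, smul_eq_mul]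

theorem twoPoint_conjMode_of_mem {v : V} {j : ℤ} (hv : v ∈ 𝒱.adjoint.wtSpace j) (l : ℤ) {w₁ : W₁}
    {w₂ : W₂} {h₁ h₂ : ℂ} (hw₁ : w₁ ∈ M₁.wtSpace h₁) (hw₂ : w₂ ∈ M₂.wtSpace h₂) :
    I.twoPoint hf (locSum (M₁.conjMode j v l) (M₁.isLocallyFinite_conjMode j v l) w₁) w₂ =
      -((-1 : ℂ) ^ l * (-1) ^ j) * I.twoPoint hf w₁
        (locSum (M₂.conjOppMode v l) (M₂.isLocallyFinite_conjOppMode v l) w₂) := by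
  obtain ⟨S, hS⟩ := 𝒱.adjoint.exists_L_one_pow_eq_zero v
  set n : ℂ := h₁ + h₂ - j with hn
  let v' (s : ℕ) : V := (𝒱.adjoint.L 1 ^ s) v
  let c (i : ℕ) : ℂ := (-1) ^ i * ((Ring.choose l i : ℤ) : ℂ)
  let A (s : ℕ) : W₃ :=
    ∑ᶠ i : ℕ, c i • M₃.mode (v' s) (2 * j - 2 - l - s + l - i) (I.coeff w₁ (n + i) w₂)
  let C (s : ℕ) : W₂ := ∑ᶠ i : ℕ, c i • M₂.mode (v' s) (2 * j - 2 - l - s + i) w₂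
  have hjacobi (s : ℕ) : I.twoPoint hf (∑ᶠ i : ℕ,
      ((Ring.choose (2 * j - 2 - l - s) i : ℤ) : ℂ) • M₁.mode (v' s) (l + i) w₁) w₂ =
        f (A s) - (-1 : ℂ) ^ l * I.twoPoint hf w₁ (C s) :=
    I.twoPoint_jacobi hf (𝒱.adjoint.L_one_pow_mem_wtSpace hv s) hw₁ hw₂
      (by rw [hn]; push_cast; ring)
  have hA : f (∑ s ∈ Finset.range S, (1 / (s.factorial : ℂ)) • A s) = 0 := by
    have hfin (s : ℕ) : (fun i : ℕ => M₃.mode (v' s) (2 * j - 2 - l - s + l - i)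
        (I.coeff w₁ (n + i) w₂)).HasFiniteSupport := by
      obtain ⟨N, hN⟩ := I.truncation w₁ w₂ n
      exact hasFiniteSupport_iff_exists_forall_ge.2 ⟨N, fun i hi => by rw [hN i hi, map_zero]⟩
    rw [M₃.sum_smul_finsum_mode hv hS c (n := fun i => i) (by intros; ring) hfin, map_smul,
      hf.apply_finsum_oppMode_eq_zero c v, smul_zero]
  have hC : ∑ s ∈ Finset.range S, (1 / (s.factorial : ℂ)) • C s =
      (-1 : ℂ) ^ j • locSum (M₂.conjOppMode v l) (M₂.isLocallyFinite_conjOppMode v l) w₂ := by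
    rw [M₂.sum_smul_finsum_mode hv hS c (n := fun i => l - i) (by intros; ring)
      fun s => M₂.isLocallyFinite_mode (v' s) _ w₂]
    rfl
  rw [M₁.locSum_conjMode_apply hS]
  calc _ = ∑ s ∈ Finset.range S, (1 / (s.factorial : ℂ)) •
        (f (A s) - (-1 : ℂ) ^ l * I.twoPoint hf w₁ (C s)) := by
        simp only [map_sum, LinearMap.sum_apply, map_smul, LinearMap.smul_apply, hjacobi, v']
    _ = f (∑ s ∈ Finset.range S, (1 / (s.factorial : ℂ)) • A s) - (-1 : ℂ) ^ l *
        I.twoPoint hf w₁ (∑ s ∈ Finset.range S, (1 / (s.factorial : ℂ)) • C s) := by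
        simp only [map_sum, map_smul, Finset.mul_sum, smul_sub, Finset.sum_sub_distrib,
          mul_smul_comm]
    _ = _ := by
        rw [hA, hC, map_smul, smul_eq_mul]
        ring

theorem twoPoint_conjMode {v : V} {j : ℤ} (hv : v ∈ 𝒱.adjoint.wtSpace j) (l : ℤ) (w₁ : W₁)
    (w₂ : W₂) :
    I.twoPoint hf (locSum (M₁.conjMode j v l) (M₁.isLocallyFinite_conjMode j v l) w₁) w₂ =
      -((-1 : ℂ) ^ l * (-1) ^ j) * I.twoPoint hf w₁
        (locSum (M₂.conjOppMode v l) (M₂.isLocallyFinite_conjOppMode v l) w₂) := by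
  let A := (I.twoPoint hf).comp (locSum (M₁.conjMode j v l) (M₁.isLocallyFinite_conjMode j v l))
  let B := (-((-1 : ℂ) ^ l * (-1) ^ j)) • (I.twoPoint hf).compl₂
    (locSum (M₂.conjOppMode v l) (M₂.isLocallyFinite_conjOppMode v l))
  have hAB : A = B := VOAModule.bilin_ext M₁ M₂ fun h₁ w₁ hw₁ h₂ w₂ hw₂ =>
    I.twoPoint_conjMode_of_mem hf hv l hw₁ hw₂
  exact LinearMap.congr_fun₂ hAB w₁ w₂

/-- The pairing `f(I(e^{L(1)} w₁, x) e^{-L(1)} w₂)` at `x = 1`. -/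
def expPairing : W₁ →ₗ[ℂ] W₂ →ₗ[ℂ] ℂ := (I.twoPoint hf).compl₁₂ (M₁.expL 1) (M₂.expL (-1))

theorem expPairing_apply (w₁ : W₁) (w₂ : W₂) :
    I.expPairing hf w₁ w₂ = I.twoPoint hf (M₁.expL 1 w₁) (M₂.expL (-1) w₂) := rfl

theorem expPairing_mode {v : V} {j : ℤ} (hv : v ∈ 𝒱.adjoint.wtSpace j) (l : ℤ) (w₁ : W₁)
    (w₂ : W₂) :
    I.expPairing hf (M₁.mode v l w₁) w₂ =
      -((-1 : ℂ) ^ l * (-1) ^ j) * I.expPairing hf w₁ (M₂.oppMode v l w₂) := by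
  rw [expPairing_apply, expPairing_apply, M₁.expL_one_mode hv, M₂.expL_neg_one_oppMode,
    I.twoPoint_conjMode hf hv]

theorem expPairing_eq_zero_of_ne {w₁ : W₁} {w₂ : W₂} {h₁ h₂ : ℂ} (hw₁ : w₁ ∈ M₁.wtSpace h₁)
    (hw₂ : w₂ ∈ M₂.wtSpace h₂) (hne : h₁ ≠ h₂) : I.expPairing hf w₁ w₂ = 0 := by
  refine VOAModule.apply_eq_zero_of_ne ?_ hw₁ hw₂ hne
  have h := I.expPairing_mode hf (j := 2) (by exact_mod_cast 𝒱.conf_mem) 1 w₁ w₂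
  norm_num [M₂.oppMode_conf_one] at h
  exact h

theorem twoPoint_eq_zero_of_expPairing_eq_zero (h : I.expPairing hf = 0) :
    I.twoPoint hf = 0 := by
  ext w₁ w₂
  have h0 := LinearMap.congr_fun₂ h (M₁.expL (-1) w₁) (M₂.expL 1 w₂)
  have hexp : M₂.expL (-1) (M₂.expL 1 w₂) = w₂ := by
    simpa using M₂.expL_apply_expL_neg_apply (-1) w₂
  rwa [expPairing_apply, M₁.expL_apply_expL_neg_apply, hexp] at h0

theorem apply_coeff_eq_zero_of_twoPoint_eq_zero (h : I.twoPoint hf = 0) (w₁ : W₁) (n : ℂ)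
    (w₂ : W₂) : f (I.coeff w₁ n w₂) = 0 := by
  have hzero : (LinearMap.proj n ∘ₗ I.coeff).compr₂ f = 0 := by
    refine VOAModule.bilin_ext M₁ M₂ fun h₁ w₁ hw₁ h₂ w₂ hw₂ => ?_
    change f (I.coeff w₁ n w₂) = 0
    by_cases hn : n = h₁ + h₂ - 1
    · rw [← I.twoPoint_of_mem hf hw₁ hw₂ hn, h]; rfl
    · exact I.apply_coeff_eq_zero hf hw₁ hw₂ hn
  exact LinearMap.congr_fun₂ hzero w₁ w₂

omit hf in
theorem apply_mode_coeff_eq_zero (h : ∀ w₁ n w₂, f (I.coeff w₁ n w₂) = 0) (v : V) (m : ℤ)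
    (w₁ : W₁) (n : ℂ) (w₂ : W₂) : f (M₃.mode v m (I.coeff w₁ n w₂)) = 0 := by
  have hcomm := (I.jacobi v).commutator w₁ w₂ m n
  rw [sub_eq_iff_eq_add.1 hcomm, map_add, h, add_zero]
  exact finsum_induction (fun w => f w = 0) (map_zero f)
    (fun x y hx hy => by rw [map_add, hx, hy, add_zero]) fun i => by rw [map_smul, h, smul_zero]

end TwoPoint

section DualForm

theorem isLocallyFinite_coeff_L_one_pow (h p : ℂ) : IsLocallyFinite fun k : ℕ =>
    (1 / (k.factorial : ℂ)) •
      (LinearMap.proj (p - 1 - k + 2 * h) ∘ₗ I.coeff : W₁ →ₗ[ℂ] W₂ →ₗ[ℂ] W₃) ∘ₗ M₁.L 1 ^ k :=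
  (M₁.isLocallyFinite_L_one_pow.comp _).smul _

/-- The coefficient of `x^p` in `I^o_r(w₁, x)`, as a linear map of `w₁`. -/
def oppHom (r : ℤ) (p : ℂ) : W₁ →ₗ[ℂ] W₂ →ₗ[ℂ] W₃ :=
  locSum (fun h : ℂ => Complex.exp ((2 * r + 1) * Real.pi * Complex.I * h) •
      locSum _ (I.isLocallyFinite_coeff_L_one_pow h p) ∘ₗ M₁.wtProj h)
    ((M₁.isLocallyFinite_wtProj.comp _).smul _)

theorem oppHom_apply (r : ℤ) (p : ℂ) (w : W₁) : I.oppHom r p w = I.opp r w p := rfl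

theorem opp_of_mem {w : W₁} {h : ℂ} (hw : w ∈ M₁.wtSpace h) (r : ℤ) (p : ℂ) :
    I.opp r w p = Complex.exp ((2 * r + 1) * Real.pi * Complex.I * h) •
      locSum _ (I.isLocallyFinite_coeff_L_one_pow h p) w := by
  rw [← oppHom_apply, oppHom, locSum_apply, finsum_eq_single _ h, LinearMap.smul_apply,
    LinearMap.comp_apply, M₁.wtProj_of_mem hw]
  intro h' hne
  rw [LinearMap.smul_apply, LinearMap.comp_apply, M₁.wtProj_of_mem_ne hw hne, map_zero, smul_zero]

theorem apply_opp_of_mem (f : Dual ℂ W₃) {w₁ : W₁} {h : ℂ} (hw₁ : w₁ ∈ M₁.wtSpace h) (p : ℂ)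
    (w₂ : W₂) : f (I.opp 0 w₁ p w₂) = Complex.exp (Real.pi * Complex.I * h) *
      ∑ᶠ k : ℕ, (1 / (k.factorial : ℂ)) * f (I.coeff ((M₁.L 1 ^ k) w₁) (p - 1 - k + 2 * h) w₂) := by
  have hexp : ((2 * (0 : ℤ) + 1 : ℂ)) * Real.pi * Complex.I * h = Real.pi * Complex.I * h := by
    simp
  rw [I.opp_of_mem hw₁, hexp, LinearMap.smul_apply, map_smul, smul_eq_mul]
  congr 1
  refine (map_locSum (f ∘ₗ LinearMap.applyₗ w₂) _ (I.isLocallyFinite_coeff_L_one_pow h p) w₁).trans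
    (finsum_congr fun k => ?_)
  rw [LinearMap.smul_apply, map_smul, smul_eq_mul]
  rfl

/-- The number `Res_x x⁻¹ f(I^o_0(w₁, e^{πi} x) e^{xL(1)} w₂)` for a functional `f` on the target of
`I`; `IntertwiningOperator.contForm` is the case `f = (𝟏, ·)_V`. -/
def dualForm (f : Dual ℂ W₃) (w₁ : W₁) (w₂ : W₂) : ℂ :=
  formalRes (mulXPow (-1) fun p => ∑ᶠ j : ℕ,
    f (substExp (Real.pi * Complex.I) (I.opp 0 w₁) (p - j)
      ((1 / (j.factorial : ℂ)) • (M₂.L 1 ^ j) w₂)))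

theorem dualForm_eq (f : Dual ℂ W₃) (w₁ : W₁) (w₂ : W₂) : I.dualForm f w₁ w₂ =
    ∑ᶠ j : ℕ, ((-1 : ℂ) ^ j * (1 / (j.factorial : ℂ))) *
      f (I.opp 0 w₁ (-j) ((M₂.L 1 ^ j) w₂)) := by
  refine finsum_congr fun j => ?_
  have hpow : (-1 : ℂ) - -1 - j = -j := by ring
  have hphase : Complex.exp (Real.pi * Complex.I * -j) = (-1) ^ j := by
    rw [show (Real.pi : ℂ) * Complex.I * -j = j * (-(Real.pi * Complex.I)) by ring,
      Complex.exp_nat_mul, Complex.exp_neg, Complex.exp_pi_mul_I, inv_neg, inv_one]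
  simp only [substExp, hpow, hphase, LinearMap.smul_apply, map_smul, smul_eq_mul]
  ring

/-- `IntertwiningOperator.dualForm` as a bilinear map. -/
def dualPairing (f : Dual ℂ W₃) : W₁ →ₗ[ℂ] W₂ →ₗ[ℂ] ℂ :=
  (locSum (fun j : ℕ => ((-1 : ℂ) ^ j * (1 / (j.factorial : ℂ))) •
      ((I.oppHom 0 (-j)).compr₂ f).flip ∘ₗ M₂.L 1 ^ j)
    ((M₂.isLocallyFinite_L_one_pow.comp _).smul _)).flip

theorem dualPairing_apply (f : Dual ℂ W₃) (w₁ : W₁) (w₂ : W₂) :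
    I.dualPairing f w₁ w₂ = I.dualForm f w₁ w₂ := by
  rw [dualForm_eq]
  exact map_locSum (LinearMap.applyₗ w₁) _ _ w₂

variable {f : Dual ℂ W₃} (hf : M₃.IsVacuumLike f)

theorem apply_opp_eq_exp_mul_twoPoint {w₁ : W₁} {w₂ : W₂} {h₁ h₂ p : ℂ}
    (hw₁ : w₁ ∈ M₁.wtSpace h₁) (hw₂ : w₂ ∈ M₂.wtSpace h₂) (hp : p = h₂ - h₁) :
    f (I.opp 0 w₁ p w₂) =
      Complex.exp (Real.pi * Complex.I * h₁) * I.twoPoint hf (M₁.expL 1 w₁) w₂ := by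
  rw [I.apply_opp_of_mem f hw₁, ← LinearMap.flip_apply, M₁.map_expL]
  congr 1
  refine finsum_congr fun k => ?_
  rw [one_pow, one_mul, smul_eq_mul, LinearMap.flip_apply,
    I.twoPoint_of_mem hf (M₁.L_one_pow_mem_wtSpace hw₁ k) hw₂ (n := p - 1 - k + 2 * h₁)]
  rw [hp]
  ring

include hf in
theorem apply_opp_eq_zero {w₁ : W₁} {w₂ : W₂} {h₁ h₂ p : ℂ} (hw₁ : w₁ ∈ M₁.wtSpace h₁)
    (hw₂ : w₂ ∈ M₂.wtSpace h₂) (hp : p ≠ h₂ - h₁) : f (I.opp 0 w₁ p w₂) = 0 := by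
  rw [I.apply_opp_of_mem f hw₁, finsum_eq_zero_of_forall_eq_zero, mul_zero]
  intro k
  rw [I.apply_coeff_eq_zero hf (M₁.L_one_pow_mem_wtSpace hw₁ k) hw₂
    fun h0 => hp (by linear_combination h0), mul_zero]

theorem dualPairing_of_mem_of_mem {w₁ : W₁} {w₂ : W₂} {h₁ h₂ : ℂ} (hw₁ : w₁ ∈ M₁.wtSpace h₁)
    (hw₂ : w₂ ∈ M₂.wtSpace h₂) : I.dualPairing f w₁ w₂ =
      Complex.exp (Real.pi * Complex.I * h₁) * I.expPairing hf w₁ w₂ := by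
  rw [dualPairing_apply, dualForm_eq]
  by_cases hne : h₁ = h₂
  · rw [expPairing_apply, M₂.map_expL, mul_finsum]
    refine finsum_congr fun j => ?_
    rw [I.apply_opp_eq_exp_mul_twoPoint hf hw₁ (M₂.L_one_pow_mem_wtSpace hw₂ j) (by rw [hne]; ring),
      smul_eq_mul, mul_left_comm]
  · rw [I.expPairing_eq_zero_of_ne hf hw₁ hw₂ hne, mul_zero]
    refine finsum_eq_zero_of_forall_eq_zero fun j => ?_
    rw [I.apply_opp_eq_zero hf hw₁ (M₂.L_one_pow_mem_wtSpace hw₂ j)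
      fun h0 => hne (by linear_combination h0), mul_zero]

theorem dualPairing_of_mem {w₁ : W₁} {h : ℂ} (hw₁ : w₁ ∈ M₁.wtSpace h) (w₂ : W₂) :
    I.dualPairing f w₁ w₂ = Complex.exp (Real.pi * Complex.I * h) * I.expPairing hf w₁ w₂ := by
  induction w₂ using M₂.wtSpace_induction with
  | hom h₂ w₂ hw₂ => exact I.dualPairing_of_mem_of_mem hf hw₁ hw₂
  | add w w' h h' => rw [map_add, map_add, h, h', mul_add]

include hf in
theorem dualPairing_mode_of_mem {v : V} {j : ℤ} (hv : v ∈ 𝒱.adjoint.wtSpace j) (n : ℤ) {w₁ : W₁}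
    {h : ℂ} (hw₁ : w₁ ∈ M₁.wtSpace h) (w₂ : W₂) :
    I.dualPairing f (M₁.mode v n w₁) w₂ = I.dualPairing f w₁ (M₂.oppMode v n w₂) := by
  have hphase : Complex.exp (Real.pi * Complex.I * (h + j - n - 1)) =
      Complex.exp (Real.pi * Complex.I * h) * (-1) ^ (j - n - 1) := by
    rw [← Complex.exp_pi_mul_I, ← Complex.exp_int_mul, ← Complex.exp_add]
    push_cast
    ring_nf
  have hsign : (-1 : ℂ) ^ (j - n - 1) * -((-1) ^ n * (-1) ^ j) = 1 := by
    rw [← zpow_add₀ (by norm_num), mul_neg, ← zpow_add₀ (by norm_num),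
      show j - n - 1 + (n + j) = j + j - 1 by ring, zpow_sub_one₀ (by norm_num),
      Even.neg_one_zpow ⟨j, rfl⟩]
    norm_num
  rw [I.dualPairing_of_mem hf (M₁.mode_mem_wtSpace hv hw₁ n), I.dualPairing_of_mem hf hw₁,
    I.expPairing_mode hf hv, hphase]
  linear_combination Complex.exp (Real.pi * Complex.I * h) *
    I.expPairing hf w₁ (M₂.oppMode v n w₂) * hsign

include hf in
theorem isInvariant_dualPairing : VOAModule.IsInvariant M₁ M₂ (I.dualPairing f) := by
  intro v n w₁ w₂
  induction v using 𝒱.wtSpace_induction with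
  | hom j v hv =>
    induction w₁ using M₁.wtSpace_induction with
    | hom h w₁ hw₁ => exact I.dualPairing_mode_of_mem hf hv n hw₁ w₂
    | add w w' h h' => simp only [map_add, LinearMap.add_apply, h, h']
  | add v v' h h' => simp only [M₁.mode_add, M₂.oppMode_add, LinearMap.add_apply, map_add, h, h']

theorem expPairing_eq_zero_of_dualPairing_eq_zero (h : I.dualPairing f = 0) :
    I.expPairing hf = 0 :=
  VOAModule.bilin_ext M₁ M₂ fun h₁ w₁ hw₁ _ w₂ _ => by
    have h0 := I.dualPairing_of_mem hf hw₁ w₂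
    rw [h] at h0
    exact (mul_eq_zero.1 h0.symm).resolve_left (Complex.exp_ne_zero _)

include hf in
theorem dualPairing_ne_zero (hsep : ∀ u, (∀ v n, M₃.contraMode v n f u = 0) → u = 0)
    (hI : I.coeff ≠ 0) : I.dualPairing f ≠ 0 := fun h0 => by
  have hcoeff := I.apply_coeff_eq_zero_of_twoPoint_eq_zero hf
    (I.twoPoint_eq_zero_of_expPairing_eq_zero hf
      (I.expPairing_eq_zero_of_dualPairing_eq_zero hf h0))
  refine hI (LinearMap.ext fun w₁ => funext fun n => LinearMap.ext fun w₂ =>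
    hsep _ fun v m => M₃.contraMode_apply_eq_zero ?_ v m)
  exact fun v m => I.apply_mode_coeff_eq_zero hcoeff v m w₁ n w₂

end DualForm

end IntertwiningOperator

namespace VOAModule

section OppositeInvolution

variable {V W : Type*} [AddCommGroup V] [Module ℂ V] [AddCommGroup W] [Module ℂ W]
  {𝒱 : VertexOperatorAlgebra V} (M : VOAModule 𝒱 W)

theorem oppMode_L_one_pow_of_mem {v : V} {j : ℤ} (hv : v ∈ 𝒱.adjoint.wtSpace j) (k : ℕ) (n : ℤ)
    (w : W) : M.oppMode ((𝒱.adjoint.L 1 ^ k) v) (2 * j - k - n - 2) w =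
      (-1 : ℂ) ^ j • ∑ᶠ i : ℕ, ((-1 : ℂ) ^ k * (1 / (i.factorial : ℂ))) •
        M.mode ((𝒱.adjoint.L 1 ^ (k + i)) v) (n - (k + i : ℕ)) w := by
  obtain ⟨S, hS⟩ := 𝒱.adjoint.exists_L_one_pow_eq_zero v
  have hS' (i : ℕ) (hi : S ≤ i) : (𝒱.adjoint.L 1 ^ i) ((𝒱.adjoint.L 1 ^ k) v) = 0 := by
    rw [← End.mul_apply, ← pow_add, hS _ (by lia)]
  have hv' : (𝒱.adjoint.L 1 ^ k) v ∈ 𝒱.adjoint.wtSpace ((j - k : ℤ) : ℂ) := by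
    exact_mod_cast 𝒱.adjoint.L_one_pow_mem_wtSpace hv k
  have hsign : (-1 : ℂ) ^ (j - k) = (-1) ^ j * (-1) ^ k := by
    rw [zpow_sub₀ (by norm_num), zpow_natCast, div_eq_mul_inv, ← inv_pow, inv_neg, inv_one]
  rw [M.oppMode_of_mem hv' hS', finsum_eq_sum_range (N := S) fun i hi => by
    rw [hS _ (by lia), mode_zero, LinearMap.zero_apply, smul_zero]]
  simp only [LinearMap.smul_apply, LinearMap.sum_apply, hsign, mul_smul, ← Finset.smul_sum]
  congr 2
  refine Finset.sum_congr rfl fun i _ => ?_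
  rw [← End.mul_apply, ← pow_add, add_comm i k]
  congr 3
  push_cast
  ring

theorem mode_of_mem {v : V} {j : ℤ} (hv : v ∈ 𝒱.adjoint.wtSpace j) {S : ℕ}
    (hS : ∀ k, S ≤ k → (𝒱.adjoint.L 1 ^ k) v = 0) (n : ℤ) :
    M.mode v n = (-1 : ℂ) ^ j • ∑ k ∈ Finset.range S, (1 / (k.factorial : ℂ)) •
      M.oppMode ((𝒱.adjoint.L 1 ^ k) v) (2 * j - k - n - 2) := by
  ext w
  let F (m : ℕ) : W := (-1 : ℂ) ^ m • M.mode ((𝒱.adjoint.L 1 ^ m) v) (n - m) w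
  have hF (m : ℕ) (hm : S ≤ m) : F m = 0 := by
    simp only [F, hS m hm, mode_zero, LinearMap.zero_apply, smul_zero]
  have hterm (k i : ℕ) : ((-1 : ℂ) ^ k * (1 / (i.factorial : ℂ))) •
      M.mode ((𝒱.adjoint.L 1 ^ (k + i)) v) (n - (k + i : ℕ)) w =
        ((-1 : ℂ) ^ i * (1 / (i.factorial : ℂ))) • F (k + i) := by
    have hsign : (-1 : ℂ) ^ i * (-1) ^ i = 1 := by rw [← mul_pow]; norm_num
    rw [smul_smul, pow_add]
    congr 1
    linear_combination (-(-1) ^ k * (1 / (i.factorial : ℂ))) * hsign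
  calc M.mode v n w = F 0 := by simp [F]
    _ = ∑ᶠ k : ℕ, (1 / (k.factorial : ℂ)) •
        ∑ᶠ i : ℕ, ((-1 : ℂ) ^ i * (1 / (i.factorial : ℂ))) • F (k + i) := by
      simp only [smul_finsum, smul_smul]
      exact (finsum_exp_mul_exp_neg_smul
        (hasFiniteSupport_iff_exists_forall_ge.2 ⟨S, hF⟩)).symm
    _ = ∑ k ∈ Finset.range S, (1 / (k.factorial : ℂ)) •
        ∑ᶠ i : ℕ, ((-1 : ℂ) ^ i * (1 / (i.factorial : ℂ))) • F (k + i) :=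
      finsum_eq_sum_range fun k hk => by
        simp only [hF (k + _) (by lia), smul_zero, finsum_zero]
    _ = (-1 : ℂ) ^ j • ∑ k ∈ Finset.range S, (1 / (k.factorial : ℂ)) •
        M.oppMode ((𝒱.adjoint.L 1 ^ k) v) (2 * j - k - n - 2) w := by
      rw [Finset.smul_sum]
      refine Finset.sum_congr rfl fun k _ => ?_
      rw [M.oppMode_L_one_pow_of_mem hv, smul_comm, smul_smul ((-1 : ℂ) ^ j),
        ← zpow_add₀ (by norm_num), Even.neg_one_zpow ⟨j, rfl⟩, one_smul]
      simp only [hterm]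
    _ = _ := by simp only [LinearMap.smul_apply, LinearMap.sum_apply]

end OppositeInvolution

variable {V W₁ W₂ : Type*} [AddCommGroup V] [Module ℂ V]
  [AddCommGroup W₁] [Module ℂ W₁] [AddCommGroup W₂] [Module ℂ W₂]
  {𝒱 : VertexOperatorAlgebra V} {M₁ : VOAModule 𝒱 W₁} {M₂ : VOAModule 𝒱 W₂}
  {B : W₁ →ₗ[ℂ] W₂ →ₗ[ℂ] ℂ}

namespace IsInvariant

theorem eq_zero_of_ne (hB : IsInvariant M₁ M₂ B) {w₁ : W₁} {w₂ : W₂} {h₁ h₂ : ℂ}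
    (hw₁ : w₁ ∈ M₁.wtSpace h₁) (hw₂ : w₂ ∈ M₂.wtSpace h₂) (hne : h₁ ≠ h₂) : B w₁ w₂ = 0 :=
  apply_eq_zero_of_ne (M₂.oppMode_conf_one ▸ hB 𝒱.conf 1 w₁ w₂) hw₁ hw₂ hne

theorem flip (hB : IsInvariant M₁ M₂ B) : IsInvariant M₂ M₁ B.flip := by
  intro v n w₂ w₁
  rw [LinearMap.flip_apply, LinearMap.flip_apply]
  induction v using 𝒱.wtSpace_induction with
  | hom j v hv =>
    obtain ⟨S, hS⟩ := 𝒱.adjoint.exists_L_one_pow_eq_zero v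
    simp only [M₂.mode_of_mem hv hS, M₁.oppMode_of_mem hv hS, LinearMap.smul_apply,
      LinearMap.sum_apply, map_smul, map_sum, hB _ _ w₁ w₂]
  | add v v' h h' =>
    simp only [M₂.mode_add, M₁.oppMode_add, LinearMap.add_apply, map_add, h, h']

theorem separatingLeft (hB : IsInvariant M₁ M₂ B) (hM₁ : M₁.IsIrreducible) (h0 : B ≠ 0) :
    B.SeparatingLeft := by
  refine LinearMap.separatingLeft_iff_ker_eq_bot.2 <|
    (hM₁.2 (LinearMap.ker B) fun v n w hw => ?_).resolve_right fun htop =>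
      h0 (LinearMap.ker_eq_top.1 htop)
  ext w₂
  rw [hB, LinearMap.mem_ker.1 hw]
  rfl

theorem nondegenerate (hB : IsInvariant M₁ M₂ B) (hM₁ : M₁.IsIrreducible)
    (hM₂ : M₂.IsIrreducible) (h0 : B ≠ 0) : B.Nondegenerate :=
  ⟨hB.separatingLeft hM₁ h0, LinearMap.flip_separatingLeft.1 <| hB.flip.separatingLeft hM₂
    fun h => h0 (LinearMap.ext₂ fun w₁ w₂ => LinearMap.congr_fun₂ h w₂ w₁)⟩

theorem mem_gradedDual (hB : IsInvariant M₁ M₂ B) (w₁ : W₁) : B w₁ ∈ M₂.gradedDual := by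
  induction w₁ using M₁.wtSpace_induction with
  | hom h w₁ hw₁ =>
    refine (Set.finite_singleton h).subset ?_
    rintro h' ⟨w₂, hw₂, hne⟩
    exact by_contra fun hh => hne (hB.eq_zero_of_ne hw₁ hw₂ (Ne.symm hh))
  | add w w' h h' => rw [map_add]; exact add_mem h h'

theorem apply_eq_zero_of_mem (hB : IsInvariant M₁ M₂ B) {h : ℂ} {w₁ : W₁}
    (hw₁ : w₁ ∈ M₁.wtSpace h) (hw : ∀ w₂ ∈ M₂.wtSpace h, B w₁ w₂ = 0) : B w₁ = 0 := by
  ext w₂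
  induction w₂ using M₂.wtSpace_induction with
  | hom h₂ w₂ hw₂ =>
    by_cases hh : h = h₂
    · exact hw w₂ (hh ▸ hw₂)
    · exact hB.eq_zero_of_ne hw₁ hw₂ hh
  | add w w' h h' => rw [map_add, h, h', map_add]

theorem injective_compl₁₂_subtype (hB : IsInvariant M₁ M₂ B) (hsep : B.SeparatingLeft) (h : ℂ) :
    Function.Injective (B.compl₁₂ (M₁.wtSpace h).subtype (M₂.wtSpace h).subtype) := by
  refine (injective_iff_map_eq_zero _).2 fun w₁ hw => Subtype.ext (hsep w₁ fun w₂ => ?_)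
  rw [hB.apply_eq_zero_of_mem w₁.2 fun w₂ hw₂ => LinearMap.congr_fun hw ⟨w₂, hw₂⟩,
    LinearMap.zero_apply]

theorem exists_eq_on_wtSpace (hB : IsInvariant M₁ M₂ B) (hnd : B.Nondegenerate)
    (f : Dual ℂ W₂) (h : ℂ) : ∃ w₁ ∈ M₁.wtSpace h, ∀ w₂ ∈ M₂.wtSpace h, B w₁ w₂ = f w₂ := by
  have : FiniteDimensional ℂ (M₁.wtSpace h) := M₁.finite_dim h
  have : FiniteDimensional ℂ (M₂.wtSpace h) := M₂.finite_dim h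
  have := LinearMap.IsPerfPair.of_injective (hB.injective_compl₁₂_subtype hnd.1 h)
    (hB.flip.injective_compl₁₂_subtype (LinearMap.flip_separatingLeft.2 hnd.2) h)
  obtain ⟨w₁, hw₁⟩ := (LinearMap.IsPerfPair.bijective_left
    (B.compl₁₂ (M₁.wtSpace h).subtype (M₂.wtSpace h).subtype)).2 (f ∘ₗ (M₂.wtSpace h).subtype)
  exact ⟨w₁, w₁.2, fun w₂ hw₂ => LinearMap.congr_fun hw₁ ⟨w₂, hw₂⟩⟩

theorem exists_apply_eq (hB : IsInvariant M₁ M₂ B) (hnd : B.Nondegenerate) {f : Dual ℂ W₂}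
    (hf : f ∈ M₂.gradedDual) : ∃ w₁, B w₁ = f := by
  classical
  have hfin : {h : ℂ | ∃ w ∈ M₂.wtSpace h, f w ≠ 0}.Finite := hf
  choose g hg hgf using hB.exists_eq_on_wtSpace hnd f
  refine ⟨∑ h ∈ hfin.toFinset, g h, LinearMap.ext fun w₂ => ?_⟩
  induction w₂ using M₂.wtSpace_induction with
  | hom h w₂ hw₂ =>
    rw [map_sum, LinearMap.sum_apply, ← hgf h w₂ hw₂]
    refine Finset.sum_eq_single h (fun h' _ hne => hB.eq_zero_of_ne (hg h') hw₂ hne) fun hh => ?_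
    rw [hgf h w₂ hw₂]
    exact by_contra fun hne => hh (hfin.mem_toFinset.2 ⟨w₂, hw₂, hne⟩)
  | add w w' h h' => rw [map_add, h, h', map_add]

theorem isoContragredient (hB : IsInvariant M₁ M₂ B) (hnd : B.Nondegenerate) :
    IsoContragredient M₁ M₂ := by
  have hinj : Function.Injective (B.codRestrict M₂.gradedDual hB.mem_gradedDual) :=
    (injective_iff_map_eq_zero _).2 fun w₁ hw =>
      hnd.1 w₁ fun w₂ => LinearMap.congr_fun (congr_arg Subtype.val hw) w₂
  have hsurj : Function.Surjective (B.codRestrict M₂.gradedDual hB.mem_gradedDual) := fun f =>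
    (hB.exists_apply_eq hnd f.2).imp fun _ hw₁ => Subtype.ext hw₁
  exact ⟨LinearEquiv.ofBijective _ ⟨hinj, hsurj⟩, fun v n w => LinearMap.ext (hB v n w)⟩

theorem isContragredientPair (hB : IsInvariant M₁ M₂ B) (hnd : B.Nondegenerate) :
    IsContragredientPair M₁ M₂ :=
  ⟨hB.isoContragredient hnd, hB.flip.isoContragredient (LinearMap.flip_nondegenerate.2 hnd)⟩

end IsInvariant

section VacuumForm

variable {form : V →ₗ[ℂ] V →ₗ[ℂ] ℂ}

theorem IsInvariant.contraMode_form_vac (hinv : IsInvariant 𝒱.adjoint 𝒱.adjoint form) (v : V)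
    (n : ℤ) : 𝒱.adjoint.contraMode v n (form 𝒱.vac) = form (𝒱.adjoint.mode v n 𝒱.vac) :=
  LinearMap.ext fun u => (hinv v n 𝒱.vac u).symm

theorem IsInvariant.isVacuumLike_form_vac (hinv : IsInvariant 𝒱.adjoint 𝒱.adjoint form) :
    𝒱.adjoint.IsVacuumLike (form 𝒱.vac) := fun v n hn => by
  rw [hinv.contraMode_form_vac, show 𝒱.adjoint.mode v n 𝒱.vac = 0 from 𝒱.creation_nonneg v n hn,
    map_zero]

theorem IsInvariant.eq_zero_of_contraMode_form_vac (hinv : IsInvariant 𝒱.adjoint 𝒱.adjoint form)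
    (hsep : form.SeparatingRight) {u : V}
    (hu : ∀ v n, 𝒱.adjoint.contraMode v n (form 𝒱.vac) u = 0) : u = 0 :=
  hsep u fun v => by
    have h := hu v (-1)
    rwa [hinv.contraMode_form_vac, show 𝒱.adjoint.mode v (-1) 𝒱.vac = v from 𝒱.creation v] at h

end VacuumForm

end VOAModule

end VOA

end

theorem mainTheorem5_general {V W₁ W₂ W₃ : Type*} [AddCommGroup V] [Module ℂ V]
    [AddCommGroup W₁] [Module ℂ W₁] [AddCommGroup W₂] [Module ℂ W₂]
    [AddCommGroup W₃] [Module ℂ W₃] {𝒱 : VOA.VertexOperatorAlgebra V}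
    {M₁ : VOA.VOAModule 𝒱 W₁} {M₂ : VOA.VOAModule 𝒱 W₂} {M₃ : VOA.VOAModule 𝒱 W₃}
    (I : VOA.IntertwiningOperator M₁ M₂ M₃) {f : Module.Dual ℂ W₃} (hf : M₃.IsVacuumLike f) :
    ∃ B : W₁ →ₗ[ℂ] W₂ →ₗ[ℂ] ℂ,
      (∀ w₁ w₂, B w₁ w₂ = I.dualForm f w₁ w₂) ∧
      VOA.VOAModule.IsInvariant M₁ M₂ B ∧
      (M₁.IsIrreducible → M₂.IsIrreducible →
        (∀ u, (∀ v n, M₃.contraMode v n f u = 0) → u = 0) → I.coeff ≠ 0 →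
        B.Nondegenerate ∧ VOA.VOAModule.IsContragredientPair M₁ M₂) := by
  have hB := I.isInvariant_dualPairing hf
  refine ⟨I.dualPairing f, I.dualPairing_apply f, hB, fun hM₁ hM₂ hsep hI => ?_⟩
  have hnd := hB.nondegenerate hM₁ hM₂ (I.dualPairing_ne_zero hf hsep hI)
  exact ⟨hnd, hB.isContragredientPair hnd⟩

theorem mainTheorem5 {V W₁ W₂ : Type*} [AddCommGroup V] [Module ℂ V]
    [AddCommGroup W₁] [Module ℂ W₁] [AddCommGroup W₂] [Module ℂ W₂]
    (𝒱 : VOA.VertexOperatorAlgebra V)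
    (form : V →ₗ[ℂ] V →ₗ[ℂ] ℂ)
    (hinv : VOA.VOAModule.IsInvariant 𝒱.adjoint 𝒱.adjoint form)
    (hnondeg : form.Nondegenerate)
    (M₁ : VOA.VOAModule 𝒱 W₁) (M₂ : VOA.VOAModule 𝒱 W₂)
    (I : VOA.IntertwiningOperator M₁ M₂ 𝒱.adjoint) :
    ∃ B : W₁ →ₗ[ℂ] W₂ →ₗ[ℂ] ℂ,
      (∀ w₁ w₂, B w₁ w₂ = I.contForm form w₁ w₂) ∧
      VOA.VOAModule.IsInvariant M₁ M₂ B ∧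
      (M₁.IsIrreducible → M₂.IsIrreducible → I.coeff ≠ 0 →
        B.Nondegenerate ∧ VOA.VOAModule.IsContragredientPair M₁ M₂) := by
  obtain ⟨B, hBI, hB, hnd⟩ := mainTheorem5_general I hinv.isVacuumLike_form_vac
  exact ⟨B, hBI, hB, fun hM₁ hM₂ =>
    hnd hM₁ hM₂ fun _ => hinv.eq_zero_of_contraMode_form_vac hnondeg.2⟩
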